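/- A superhermitian space $(S,h)$ is a complex vector space $S$ of finite even dimension, here assumed nonzero, with a nondegenerate Hermitian form $h$ of zero signature. Put $n=\tfrac12\dim_{\mathbb C}S\ge 1$. A superlagrangian subspace is an $n$-dimensional complex subspace of $S$ on which $h$ vanishes identically. The set $\mathscr U=\mathscr U(S,h)$ of all superlagrangian subspaces (the $\mathscr U$-manifold) carries the topology of the Grassmannian of $S$. For $P_0\in\mathscr U$ let $\mathscr S(P_0)=\{P\in\mathscr U:\dim(P\cap P_0)\ge 1\}$. A continuous path $p\colon[a,b]\to\mathscr U$, where $a<b$ are arbitrary real numbers, is called admissible (for $P_0$) if $p(a),p(b)\notin\mathscr S(P_0)$. **Theorem (existence and uniqueness of the EM-index).** Fix $P_0\in\mathscr U$. There is one and only one map $\mu_{\mathrm{EM}}(\cdot,P_0)$ that assigns an integer to every admissible continuous path (on every interval $[a,b]$ with $a<b$) and satisfies the following axioms. 1. (Homotopy invariance) If $p_0,p_1\colon[a,b]\to\mathscr U$ are joined by a continuous homotopy $(p_s)_{s\in[0,1]}$ with $p_s(a),p_s(b)\notin\mathscr S(P_0)$ for all $s$, then $\mu_{\mathrm{EM}}(p_0,P_0)=\mu_{\mathrm{EM}}(p_1,P_0)$.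 2. (Catenation) If $a<c<b$ and $p(c)\notin\mathscr S(P_0)$, then $\mu_{\mathrm{EM}}(p,P_0)=\mu_{\mathrm{EM}}(p|_{[a,c]},P_0)+\mu_{\mathrm{EM}}(p|_{[c,b]},P_0)$. 3. (Localization) Let $\Phi\colon\mathbb C^n\times\mathbb C^n\to S$ be a linear isomorphism with $h[\Phi(\xi,\eta)]=\operatorname{Im}\sum_k\xi_k\overline{\eta_k}$ for all $\xi,\eta\in\mathbb C^n$ and $\Phi(\mathbb C^n\times\{0\})=P_0$. Let $H$ be a differentiable path of Hermitian $n\times n$ matrices on $[a,b]$ such that the path $p(t)=\Phi(\mathrm{Graph}\,H(t))$, where $\mathrm{Graph}\,H(t)=\{(x,H(t)x)\}$, is admissible and meets $\mathscr S(P_0)$ at exactly one instant $t_0$. Suppose that this crossing is regular, that is, the Hermitian form $u\mapsto\langle H'(t_0)u,u\rangle$ on $\ker H(t_0)$ is nondegenerate. Then for every $\varepsilon>0$ with $t_0\pm\varepsilon\in[a,b]$ $$\mu_{\mathrm{EM}}(p,P_0)=\tfrac12\,\mathrm{sign}\,H(t_0+\varepsilon)-\tfrac12\,\mathrm{sign}\,H(t_0-\varepsilon),$$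 where $\mathrm{sign}$ is the number of positive eigenvalues minus the number of negative eigenvalues. Moreover, there is an integer-valued map on all continuous paths in $\mathscr U$, admissible or not, that satisfies the same three axioms, where (2) is required of every continuous path $p$ with $p(c)\notin\mathscr S(P_0)$; on admissible paths it necessarily agrees with $\mu_{\mathrm{EM}}(\cdot,P_0)$. -/

import Mathlib

open scoped ComplexConjugate Matrix

noncomputable section

namespace EdwardsMaslov

/-! ### Superhermitian spaces and the `U`-manifold -/

section Superhermitian

variable {S : Type*} [AddCommGroup S] [Module ℂ S]

/-- The largest dimension of a complex subspace on which the Hermitian form `v ↦ h v v`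
is positive definite. -/
def posIndex (h : S →ₗ⋆[ℂ] S →ₗ[ℂ] ℂ) : ℕ :=
  sSup {k : ℕ | ∃ W : Submodule ℂ S, Module.finrank ℂ W = k ∧ ∀ v ∈ W, v ≠ 0 → 0 < (h v v).re}

/-- The largest dimension of a complex subspace on which the Hermitian form `v ↦ h v v`
is negative definite. -/
def negIndex (h : S →ₗ⋆[ℂ] S →ₗ[ℂ] ℂ) : ℕ := posIndex (-h)

/-- A superhermitian structure: a nondegenerate Hermitian form of zero signature on a complex
vector space of finite even dimension. The form is given by its symmetric sesquilinear
form `h`; its value at `v` is the real number `h v v`. -/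
structure IsSuperhermitian (h : S →ₗ⋆[ℂ] S →ₗ[ℂ] ℂ) : Prop where
  finite : FiniteDimensional ℂ S
  even : Even (Module.finrank ℂ S)
  symm : h.IsSymm
  nondegenerate : h.Nondegenerate
  signature_eq_zero : (posIndex h : ℤ) - (negIndex h : ℤ) = 0

/-- Superlagrangian subspaces: half-dimensional subspaces on which `h` vanishes identically. -/
def IsSuperlagrangian (h : S →ₗ⋆[ℂ] S →ₗ[ℂ] ℂ) (L : Submodule ℂ S) : Prop :=
  2 * Module.finrank ℂ L = Module.finrank ℂ S ∧ ∀ v ∈ L, h v v = 0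

/-- The `U`-manifold of `(S, h)`, as a set. -/
def UManifold (h : S →ₗ⋆[ℂ] S →ₗ[ℂ] ℂ) : Type _ :=
  {L : Submodule ℂ S // IsSuperlagrangian h L}

/-- The underlying subspace of a point of the `U`-manifold. -/
def UManifold.space {h : S →ₗ⋆[ℂ] S →ₗ[ℂ] ℂ} (P : UManifold h) : Submodule ℂ S := P.1

/-- The singular variety of `P₀`: the superlagrangian subspaces whose intersection with `P₀`
has dimension at least one. -/
def singularSet {h : S →ₗ⋆[ℂ] S →ₗ[ℂ] ℂ} (P₀ : UManifold h) : Set (UManifold h) :=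
  {P | 1 ≤ Module.finrank ℂ ↥(P.space ⊓ P₀.space)}

end Superhermitian

/-- The topology of the `U`-manifold as a subspace of the Grassmannian of `S`: a subspace is
identified with the orthogonal projection onto it. In finite dimension the resulting topology
does not depend on the auxiliary inner product of `S`. -/
instance UManifold.instTopologicalSpace {S : Type*} [NormedAddCommGroup S]
    [InnerProductSpace ℂ S] [FiniteDimensional ℂ S] (h : S →ₗ⋆[ℂ] S →ₗ[ℂ] ℂ) :
    TopologicalSpace (UManifold h) :=
  TopologicalSpace.induced (fun P : UManifold h => P.space.starProjection) inferInstance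

/-! ### Hermitian matrices -/

/-- The signature of a Hermitian matrix: the number of positive eigenvalues minus the number of
negative eigenvalues, counted with multiplicity. -/
def matrixSign {n : ℕ} {A : Matrix (Fin n) (Fin n) ℂ} (hA : A.IsHermitian) : ℤ :=
  (Fintype.card {i // 0 < hA.eigenvalues i} : ℤ) - (Fintype.card {i // hA.eigenvalues i < 0} : ℤ)

/-- The graph `{(x, A x)}` of a matrix, as a subspace of `ℂⁿ × ℂⁿ`. -/
def matrixGraph {n : ℕ} (A : Matrix (Fin n) (Fin n) ℂ) :
    Submodule ℂ ((Fin n → ℂ) × (Fin n → ℂ)) :=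
  (Matrix.toLin' A).graph

/-- The crossing form at `t₀` of a path `H` of Hermitian matrices is the Hermitian form
`⟨u, H'(t₀) u⟩` on `ker H(t₀)`. The crossing is regular when this form is nondegenerate. -/
def IsRegularCrossing {n : ℕ} (H : ℝ → Matrix (Fin n) (Fin n) ℂ) (t₀ : ℝ) : Prop :=
  ∀ u : Fin n → ℂ, H t₀ *ᵥ u = 0 →
    (∀ w : Fin n → ℂ, H t₀ *ᵥ w = 0 → star w ⬝ᵥ (deriv H t₀ *ᵥ u) = 0) → u = 0

/-- The standard superhermitian structure `Im ⟨ξ, η⟩` of `ℂⁿ × ℂⁿ`, where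
`⟨ξ, η⟩ = ∑ ξₖ conj ηₖ`. -/
def stdForm {n : ℕ} (z : (Fin n → ℂ) × (Fin n → ℂ)) : ℝ :=
  (∑ k, z.1 k * conj (z.2 k)).im

/-- `Φ` identifies `(ℂⁿ × ℂⁿ, stdForm)` with `(S, h)` and `ℂⁿ × {0}` with `P₀`. -/
structure IsAdapted {S : Type*} [AddCommGroup S] [Module ℂ S] {h : S →ₗ⋆[ℂ] S →ₗ[ℂ] ℂ}
    (P₀ : UManifold h) {n : ℕ} (Φ : ((Fin n → ℂ) × (Fin n → ℂ)) ≃ₗ[ℂ] S) : Prop where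
  isometry : ∀ z, h (Φ z) (Φ z) = (stdForm z : ℂ)
  map_horizontal : Submodule.map (Φ : ((Fin n → ℂ) × (Fin n → ℂ)) →ₗ[ℂ] S)
    (Submodule.prod ⊤ ⊥) = P₀.space

/-! ### Paths and the axioms -/

section Paths

variable {S : Type*} [NormedAddCommGroup S] [InnerProductSpace ℂ S] [FiniteDimensional ℂ S]
  {h : S →ₗ⋆[ℂ] S →ₗ[ℂ] ℂ}

/-- A continuous path `[a, b] → 𝒰(S, h)`, where `a < b` are arbitrary real numbers. -/
structure UPath (h : S →ₗ⋆[ℂ] S →ₗ[ℂ] ℂ) where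
  a : ℝ
  b : ℝ
  lt : a < b
  toMap : C(Set.Icc a b, UManifold h)

namespace UPath

/-- The value of a path at a point of its interval. -/
def at' (p : UPath h) (t : ℝ) (ht : t ∈ Set.Icc p.a p.b) : UManifold h := p.toMap ⟨t, ht⟩

/-- The restriction of a path to `[c, d] ⊆ [a, b]`, where `c < d`. -/
def restrict (p : UPath h) (c d : ℝ) (hcd : c < d) (hac : p.a ≤ c) (hdb : d ≤ p.b) : UPath h where
  a := c
  b := d
  lt := hcd
  toMap := p.toMap.comp
    ⟨Set.inclusion (Set.Icc_subset_Icc hac hdb), continuous_inclusion _⟩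

/-- Admissible paths: both endpoints lie off the singular variety of `P₀`. -/
def admissible (P₀ : UManifold h) : Set (UPath h) :=
  {p | p.toMap ⟨p.a, Set.left_mem_Icc.2 p.lt.le⟩ ∉ singularSet P₀ ∧
    p.toMap ⟨p.b, Set.right_mem_Icc.2 p.lt.le⟩ ∉ singularSet P₀}

end UPath

/-- The axioms of the EM-index relative to `P₀`, for an integer-valued map `μ` that is defined
on a class `D` of continuous paths of superlagrangian subspaces. -/
structure IsEMIndex (P₀ : UManifold h) (D : Set (UPath h)) (μ : D → ℤ) : Prop where
  /-- Two paths on the same interval that are homotopic through paths with endpoints off the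
  singular variety have the same index. -/
  homotopy : ∀ (a b : ℝ) (hab : a < b) (p q : C(Set.Icc a b, UManifold h))
    (hp : (⟨a, b, hab, p⟩ : UPath h) ∈ D) (hq : (⟨a, b, hab, q⟩ : UPath h) ∈ D),
    ContinuousMap.HomotopicWith p q (fun r => (⟨a, b, hab, r⟩ : UPath h) ∈ UPath.admissible P₀) →
    μ ⟨⟨a, b, hab, p⟩, hp⟩ = μ ⟨⟨a, b, hab, q⟩, hq⟩
  /-- Additivity under cutting a path at an interior point `c` with `p c` off the singular
  variety. -/
  catenation : ∀ (p : UPath h) (c : ℝ) (hac : p.a < c) (hcb : c < p.b) (hp : p ∈ D)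
    (hl : p.restrict p.a c hac le_rfl hcb.le ∈ D) (hr : p.restrict c p.b hcb hac.le le_rfl ∈ D),
    p.at' c ⟨hac.le, hcb.le⟩ ∉ singularSet P₀ →
    μ ⟨p, hp⟩ = μ ⟨p.restrict p.a c hac le_rfl hcb.le, hl⟩
      + μ ⟨p.restrict c p.b hcb hac.le le_rfl, hr⟩
  /-- For an admissible path of graphs of a differentiable path `H` of Hermitian matrices with a
  single crossing, which is regular, the index is half the jump of the signature. -/
  localization : ∀ (n : ℕ) (Φ : ((Fin n → ℂ) × (Fin n → ℂ)) ≃ₗ[ℂ] S), IsAdapted P₀ Φ →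
    ∀ (p : UPath h) (hp : p ∈ D), p ∈ UPath.admissible P₀ →
    ∀ (H : ℝ → Matrix (Fin n) (Fin n) ℂ)
      (hH : ∀ t ∈ Set.Icc p.a p.b, (H t).IsHermitian),
    DifferentiableOn ℝ H (Set.Icc p.a p.b) →
    (∀ t (ht : t ∈ Set.Icc p.a p.b), (p.at' t ht).space =
      Submodule.map (Φ : ((Fin n → ℂ) × (Fin n → ℂ)) →ₗ[ℂ] S) (matrixGraph (H t))) →
    ∀ t₀ ∈ Set.Icc p.a p.b,
    (∀ t (ht : t ∈ Set.Icc p.a p.b), p.at' t ht ∈ singularSet P₀ ↔ t = t₀) →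
    IsRegularCrossing H t₀ →
    ∀ ε : ℝ, 0 < ε → ∀ (h₁ : t₀ - ε ∈ Set.Icc p.a p.b) (h₂ : t₀ + ε ∈ Set.Icc p.a p.b),
    (μ ⟨p, hp⟩ : ℚ) =
      1 / 2 * (matrixSign (hH (t₀ + ε) h₂) : ℚ) - 1 / 2 * (matrixSign (hH (t₀ - ε) h₁) : ℚ)

end Paths

end EdwardsMaslov

end

/-! Existence. In adapted coordinates the Cayley transform `(w, v) = (ξ + iη, ξ - iη)` turns `4 Im
⟨ξ, η⟩` into `|w|² - |v|²`. Hence every superlagrangian subspace is the graph of a unitary matrix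
`U`, and it is singular for `P₀` exactly when `1` is an eigenvalue of `U`. The nonsingular subspaces
are the graphs of Hermitian matrices over the second factor (`IsAdapted.notMem_singularSet_iff`).
They form a contractible cell, on which `det U` has a continuous argument, `cellArg`. The index of a
path is `1 / (2π)` times the variation of `cellArg` minus the variation of a continuous argument of
`det U` along the path. It is an integer because both functions are arguments of the same number, it
is locally constant under homotopies with nonsingular ends, and it is additive by telescoping.

On graphs of Hermitian matrices `X` over `P₀`, a continuous argument is `-2 ∑ arctan λ`. Since
`arctan x + arctan x⁻¹ = ±π/2`, it differs from `cellArg` by `nπ + π sign X` when `X` is invertible,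
and the index is half the jump of the signature. Another adapted coordinate system gives the same
value, because adapted systems can be deformed into each other (`exists_path_isAdapted`) while the
ends of the path stay nonsingular.

Uniqueness. Inside one chart, a path of Hermitian matrices with invertible ends deforms, with ends
invertible throughout, to a path from an involution `σ` to `1` and on to an involution `τ`. Each
half is a linear pencil with at most one crossing, which is regular, so localization and catenation
determine the index (`agreeOn_of_mem_chart`). The constant path at `1` is treated as the difference
of two paths with one crossing. A general path is cut into pieces that lie in charts. The cutting
points may be singular, so the path is first rotated by a small angle, `U ↦ zU`, which makes them
nonsingular and moves the ends only through nonsingular subspaces (`agreeOn_segment`). -/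

set_option linter.unusedSectionVars false

noncomputable section

namespace EdwardsMaslov

/-! ### Continuity of subspaces given by continuous frames -/

section Frames

variable {S : Type*} [NormedAddCommGroup S] [InnerProductSpace ℂ S] [FiniteDimensional ℂ S]

/-- The orthogonal projection onto the range of an injective linear map. -/
theorem starProjection_range_eq {E : Type*} [NormedAddCommGroup E] [InnerProductSpace ℂ E]
    [FiniteDimensional ℂ E] (N : E →L[ℂ] S) (hN : Function.Injective N) :
    IsUnit (ContinuousLinearMap.adjoint N ∘L N) ∧
    (LinearMap.range (N : E →ₗ[ℂ] S)).starProjection =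
      N ∘L (Ring.inverse (ContinuousLinearMap.adjoint N ∘L N)) ∘L ContinuousLinearMap.adjoint N := by
  -- `⟨N* N x, x⟩ = ‖N x‖²`, so `N* N` has no kernel.
  have hinj : Function.Injective (ContinuousLinearMap.adjoint N ∘L N) := by
    rw [injective_iff_map_eq_zero]
    intro x hx
    have : inner ℂ (N x) (N x) = 0 := by
      rw [← ContinuousLinearMap.adjoint_inner_left]
      have h2 : ContinuousLinearMap.adjoint N (N x) = 0 := hx
      rw [h2, inner_zero_left]
    exact hN (by rw [inner_self_eq_zero.1 this, map_zero])
  have hu : IsUnit (ContinuousLinearMap.adjoint N ∘L N) := by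
    rw [ContinuousLinearMap.isUnit_iff_bijective]
    exact ⟨hinj, LinearMap.surjective_of_injective
      (f := ((ContinuousLinearMap.adjoint N ∘L N : E →L[ℂ] E) : E →ₗ[ℂ] E)) hinj⟩
  refine ⟨hu, ?_⟩
  ext v
  apply Submodule.eq_starProjection_of_mem_of_inner_eq_zero
  · exact ⟨_, rfl⟩
  · rintro _ ⟨x, rfl⟩
    have h1 := Ring.mul_inverse_cancel _ hu
    have h2 := congrArg (fun T : E →L[ℂ] E => T (ContinuousLinearMap.adjoint N v)) h1
    simp only [mul_apply_eq_comp, ContinuousLinearMap.comp_apply,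
      one_apply_eq_self] at h2
    simp only [ContinuousLinearMap.coe_coe, ContinuousLinearMap.comp_apply]
    rw [← ContinuousLinearMap.adjoint_inner_left, map_sub, h2, sub_self, inner_zero_left]

/-- The range of an injective linear map, as a point of the Grassmannian, depends continuously
on the map. -/
theorem continuous_starProjection_range {X : Type*} [TopologicalSpace X] {n : ℕ}
    (M : X → (Fin n → ℂ) →ₗ[ℂ] S) (hM : ∀ v, Continuous fun x => M x v)
    (hinj : ∀ x, Function.Injective (M x)) :
    Continuous fun x => (LinearMap.range (M x)).starProjection := by
  -- Adjoints need an inner product on the source, and `Fin n → ℂ` carries the sup norm.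
  let e : EuclideanSpace ℂ (Fin n) ≃ₗ[ℂ] (Fin n → ℂ) := WithLp.linearEquiv 2 ℂ (Fin n → ℂ)
  let N : X → EuclideanSpace ℂ (Fin n) →L[ℂ] S := fun x =>
    LinearMap.toContinuousLinearMap (M x ∘ₗ (e : EuclideanSpace ℂ (Fin n) →ₗ[ℂ] (Fin n → ℂ)))
  have hNc : Continuous N := continuous_clm_apply.2 fun v => hM (e v)
  have hNi : ∀ x, Function.Injective (N x) := fun x => (hinj x).comp e.injective
  have hr : ∀ x, LinearMap.range (M x) = LinearMap.range (N x : EuclideanSpace ℂ (Fin n) →ₗ[ℂ] S) := by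
    intro x
    change _ = LinearMap.range (M x ∘ₗ (e : EuclideanSpace ℂ (Fin n) →ₗ[ℂ] (Fin n → ℂ)))
    rw [LinearMap.range_comp_of_range_eq_top _ (LinearEquiv.range e)]
  have hadj : Continuous fun x => ContinuousLinearMap.adjoint (N x) :=
    ContinuousLinearMap.adjoint.continuous.comp hNc
  have hG : Continuous fun x => ContinuousLinearMap.adjoint (N x) ∘L N x := hadj.clm_comp hNc
  have hinv : Continuous fun x => Ring.inverse (ContinuousLinearMap.adjoint (N x) ∘L N x) := by
    rw [continuous_iff_continuousAt]
    intro x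
    obtain ⟨u, hu⟩ := (starProjection_range_eq (N x) (hNi x)).1
    have := NormedRing.inverse_continuousAt u
    rw [hu] at this
    exact ContinuousAt.comp (f := fun x => ContinuousLinearMap.adjoint (N x) ∘L N x) this
      hG.continuousAt
  have : (fun x => (LinearMap.range (M x)).starProjection) = fun x =>
      N x ∘L Ring.inverse (ContinuousLinearMap.adjoint (N x) ∘L N x) ∘L
        ContinuousLinearMap.adjoint (N x) := by
    funext x
    rw [← (starProjection_range_eq (N x) (hNi x)).2]
    congr 1
    exact hr x
  rw [this]
  exact hNc.clm_comp (hinv.clm_comp hadj)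

variable {h : S →ₗ⋆[ℂ] S →ₗ[ℂ] ℂ}

theorem UManifold.continuous_iff {X : Type*} [TopologicalSpace X] {P : X → UManifold h} :
    Continuous P ↔ Continuous fun x => (P x).space.starProjection :=
  continuous_induced_rng

theorem UManifold.ext {P Q : UManifold h} (hPQ : P.space = Q.space) : P = Q := Subtype.ext hPQ

/-- A family of superlagrangian subspaces with a continuous frame is continuous. -/
theorem UManifold.continuous_of_frame {X : Type*} [TopologicalSpace X] {n : ℕ}
    {P : X → UManifold h} (M : X → (Fin n → ℂ) →ₗ[ℂ] S) (hM : ∀ v, Continuous fun x => M x v)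
    (hinj : ∀ x, Function.Injective (M x)) (hP : ∀ x, (P x).space = LinearMap.range (M x)) :
    Continuous P := by
  rw [UManifold.continuous_iff]
  convert continuous_starProjection_range M hM hinj using 3 with x
  exact hP x

end Frames

/-! ### Graph charts of the `U`-manifold -/

section Charts

variable {S : Type*} [NormedAddCommGroup S] [InnerProductSpace ℂ S] [FiniteDimensional ℂ S]
  {n : ℕ}

/-- The image of the graph of a matrix under coordinates `Ψ`. -/
def graphSpace (Ψ : ((Fin n → ℂ) × (Fin n → ℂ)) ≃ₗ[ℂ] S) (X : Matrix (Fin n) (Fin n) ℂ) :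
    Submodule ℂ S :=
  Submodule.map (Ψ : ((Fin n → ℂ) × (Fin n → ℂ)) →ₗ[ℂ] S) (matrixGraph X)

theorem mem_graphSpace {Ψ : ((Fin n → ℂ) × (Fin n → ℂ)) ≃ₗ[ℂ] S} {X : Matrix (Fin n) (Fin n) ℂ}
    {v : S} : v ∈ graphSpace Ψ X ↔ ∃ x, Ψ (x, X *ᵥ x) = v := by
  unfold graphSpace matrixGraph
  constructor
  · rintro ⟨⟨x, y⟩, hxy, rfl⟩
    rw [SetLike.mem_coe, LinearMap.mem_graph_iff] at hxy
    simp only [Matrix.toLin'_apply] at hxy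
    exact ⟨x, by rw [← hxy]; rfl⟩
  · rintro ⟨x, rfl⟩
    exact ⟨(x, X *ᵥ x), by simp [LinearMap.mem_graph_iff], rfl⟩

/-- The frame `x ↦ Ψ (x, X x)` of `graphSpace Ψ X`. -/
def graphFrame (Ψ : ((Fin n → ℂ) × (Fin n → ℂ)) ≃ₗ[ℂ] S) (X : Matrix (Fin n) (Fin n) ℂ) :
    (Fin n → ℂ) →ₗ[ℂ] S :=
  (Ψ : ((Fin n → ℂ) × (Fin n → ℂ)) →ₗ[ℂ] S) ∘ₗ (LinearMap.id.prod (Matrix.toLin' X))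

theorem graphFrame_apply (Ψ : ((Fin n → ℂ) × (Fin n → ℂ)) ≃ₗ[ℂ] S)
    (X : Matrix (Fin n) (Fin n) ℂ) (x : Fin n → ℂ) : graphFrame Ψ X x = Ψ (x, X *ᵥ x) := rfl

theorem graphFrame_injective (Ψ : ((Fin n → ℂ) × (Fin n → ℂ)) ≃ₗ[ℂ] S)
    (X : Matrix (Fin n) (Fin n) ℂ) : Function.Injective (graphFrame Ψ X) := by
  intro x y hxy
  exact congrArg Prod.fst (Ψ.injective hxy)

theorem range_graphFrame (Ψ : ((Fin n → ℂ) × (Fin n → ℂ)) ≃ₗ[ℂ] S)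
    (X : Matrix (Fin n) (Fin n) ℂ) : LinearMap.range (graphFrame Ψ X) = graphSpace Ψ X := by
  ext v
  rw [mem_graphSpace]
  rfl

theorem finrank_graphSpace (Ψ : ((Fin n → ℂ) × (Fin n → ℂ)) ≃ₗ[ℂ] S)
    (X : Matrix (Fin n) (Fin n) ℂ) : Module.finrank ℂ (graphSpace Ψ X) = n := by
  rw [← range_graphFrame, LinearMap.finrank_range_of_inj (graphFrame_injective Ψ X)]
  simp

theorem graphSpace_injective (Ψ : ((Fin n → ℂ) × (Fin n → ℂ)) ≃ₗ[ℂ] S) :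
    Function.Injective (graphSpace Ψ) := by
  intro X Y hXY
  refine Matrix.ext_col fun i => ?_
  have : Ψ (Pi.single i 1, X *ᵥ (Pi.single i 1)) ∈ graphSpace Ψ Y := by
    rw [← hXY, mem_graphSpace]
    exact ⟨_, rfl⟩
  obtain ⟨x, hx⟩ := mem_graphSpace.1 this
  have h1 := Ψ.injective hx
  simp only [Prod.mk.injEq] at h1
  rw [h1.1] at h1
  simpa using h1.2.symm

theorem finrank_of_coordinates (Ψ : ((Fin n → ℂ) × (Fin n → ℂ)) ≃ₗ[ℂ] S) :
    Module.finrank ℂ S = 2 * n := by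
  rw [← Ψ.finrank_eq]
  simp
  ring

variable {h : S →ₗ⋆[ℂ] S →ₗ[ℂ] ℂ}

theorem UManifold.finrank_space (Ψ : ((Fin n → ℂ) × (Fin n → ℂ)) ≃ₗ[ℂ] S) (P : UManifold h) :
    Module.finrank ℂ P.space = n := by
  have h1 := P.2.1
  rw [finrank_of_coordinates Ψ] at h1
  exact Nat.eq_of_mul_eq_mul_left two_pos h1

/-- An `n`-dimensional subspace that meets the vertical factor trivially projects isomorphically
onto the first factor. The inverse of this projection followed by the second coordinate is the
matrix. -/
theorem exists_eq_graphSpace (Ψ : ((Fin n → ℂ) × (Fin n → ℂ)) ≃ₗ[ℂ] S) (L : Submodule ℂ S)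
    (hL : Module.finrank ℂ L = n) (ht : ∀ y, Ψ (0, y) ∈ L → y = 0) :
    ∃ X, L = graphSpace Ψ X := by
  let A : L →ₗ[ℂ] (Fin n → ℂ) :=
    LinearMap.fst ℂ _ _ ∘ₗ (Ψ.symm : S →ₗ[ℂ] ((Fin n → ℂ) × (Fin n → ℂ))) ∘ₗ L.subtype
  have hA : Function.Injective A := by
    rw [injective_iff_map_eq_zero]
    intro v hv
    have h1 : (v : S) = Ψ (0, (Ψ.symm v).2) := by
      rw [← show (Ψ.symm (v : S)).1 = 0 from hv]
      simp
    have h2 := ht _ (h1 ▸ v.2)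
    rw [h2] at h1
    apply Subtype.ext
    rw [h1]
    exact map_zero Ψ
  let e : L ≃ₗ[ℂ] (Fin n → ℂ) := LinearEquiv.ofInjectiveOfFinrankEq A hA (by simp [hL])
  have he : ∀ v, e v = A v := fun v => rfl
  let X : Matrix (Fin n) (Fin n) ℂ := LinearMap.toMatrix'
    (LinearMap.snd ℂ _ _ ∘ₗ (Ψ.symm : S →ₗ[ℂ] ((Fin n → ℂ) × (Fin n → ℂ))) ∘ₗ L.subtype ∘ₗ
      (e.symm : (Fin n → ℂ) →ₗ[ℂ] L))
  refine ⟨X, ?_⟩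
  symm
  apply Submodule.eq_of_le_of_finrank_eq
  · intro v hv
    obtain ⟨x, rfl⟩ := mem_graphSpace.1 hv
    have h1 : X *ᵥ x = (Ψ.symm (e.symm x : S)).2 := by
      rw [← Matrix.toLin'_apply]
      simp [X]
    have h2 : x = (Ψ.symm (e.symm x : S)).1 := by
      conv_lhs => rw [← e.apply_symm_apply x, he]
      rfl
    have h3 : Ψ (x, X *ᵥ x) = e.symm x := by
      rw [h1]
      nth_rw 1 [h2]
      simp
    rw [h3]
    exact (e.symm x).2
  · rw [finrank_graphSpace, hL]

/-- The domain of the affine chart of the `U`-manifold defined by coordinates `Ψ`: the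
superlagrangian subspaces that are graphs. -/
def chart (h : S →ₗ⋆[ℂ] S →ₗ[ℂ] ℂ) (Ψ : ((Fin n → ℂ) × (Fin n → ℂ)) ≃ₗ[ℂ] S) :
    Set (UManifold h) :=
  {P | ∃ X, P.space = graphSpace Ψ X}

open Classical in
/-- The matrix of which a subspace is the graph. -/
def slope (Ψ : ((Fin n → ℂ) × (Fin n → ℂ)) ≃ₗ[ℂ] S) (P : UManifold h) :
    Matrix (Fin n) (Fin n) ℂ :=
  if hP : ∃ X, P.space = graphSpace Ψ X then hP.choose else 0

theorem graphSpace_slope {Ψ : ((Fin n → ℂ) × (Fin n → ℂ)) ≃ₗ[ℂ] S} {P : UManifold h}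
    (hP : P ∈ chart h Ψ) : P.space = graphSpace Ψ (slope Ψ P) := by
  have hP' : ∃ X, P.space = graphSpace Ψ X := hP
  unfold slope
  rw [dif_pos hP']
  exact hP'.choose_spec

theorem slope_eq {Ψ : ((Fin n → ℂ) × (Fin n → ℂ)) ≃ₗ[ℂ] S} {P : UManifold h}
    {X : Matrix (Fin n) (Fin n) ℂ} (hP : P.space = graphSpace Ψ X) : slope Ψ P = X := by
  apply graphSpace_injective Ψ
  rw [← hP, ← graphSpace_slope ⟨X, hP⟩]

theorem mem_chart_iff {Ψ : ((Fin n → ℂ) × (Fin n → ℂ)) ≃ₗ[ℂ] S} {P : UManifold h} :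
    P ∈ chart h Ψ ↔ ∀ y, Ψ (0, y) ∈ P.space → y = 0 := by
  constructor
  · rintro ⟨X, hX⟩ y hy
    rw [hX] at hy
    obtain ⟨x, hx⟩ := mem_graphSpace.1 hy
    have h1 := Ψ.injective hx
    simp only [Prod.mk.injEq] at h1
    rw [← h1.2, h1.1, Matrix.mulVec_zero]
  · exact exists_eq_graphSpace Ψ P.space (P.finrank_space Ψ)

/-- The orthogonal projection onto `P` carries the frame of `P₁` to vectors of `P` with coordinates
`(N, M)`, linear in the projection and hence continuous in `P`. Wherever `N` is invertible, `P` is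
the graph of `M N⁻¹`, and `N = 1` at `P₁`. -/
theorem slope_continuous_aux (Ψ : ((Fin n → ℂ) × (Fin n → ℂ)) ≃ₗ[ℂ] S) {P₁ : UManifold h}
    (hP₁ : P₁ ∈ chart h Ψ) :
    (∀ᶠ P in nhds P₁, P ∈ chart h Ψ) ∧ ContinuousAt (slope Ψ : UManifold h → _) P₁ := by
  obtain ⟨X₁, hX₁⟩ := hP₁
  let A : S →ₗ[ℂ] (Fin n → ℂ) :=
    LinearMap.fst ℂ _ _ ∘ₗ (Ψ.symm : S →ₗ[ℂ] ((Fin n → ℂ) × (Fin n → ℂ)))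
  let B : S →ₗ[ℂ] (Fin n → ℂ) :=
    LinearMap.snd ℂ _ _ ∘ₗ (Ψ.symm : S →ₗ[ℂ] ((Fin n → ℂ) × (Fin n → ℂ)))
  let lin (T : S →ₗ[ℂ] (Fin n → ℂ)) : (S →L[ℂ] S) →ₗ[ℂ] Matrix (Fin n) (Fin n) ℂ :=
    { toFun := fun p => LinearMap.toMatrix' (T ∘ₗ (p : S →ₗ[ℂ] S) ∘ₗ graphFrame Ψ X₁)
      map_add' := by intros; ext; simp [LinearMap.toMatrix'_apply]
      map_smul' := by intros; ext; simp [LinearMap.toMatrix'_apply] }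
  have hlin : ∀ T, Continuous fun P : UManifold h => lin T P.space.starProjection := fun T =>
    (LinearMap.continuous_of_finiteDimensional (lin T)).comp continuous_induced_dom
  let N := fun P : UManifold h => lin A P.space.starProjection
  let M := fun P : UManifold h => lin B P.space.starProjection
  have hNv : ∀ P x, N P *ᵥ x = A (P.space.starProjection (graphFrame Ψ X₁ x)) := by
    intro P x
    rw [← Matrix.toLin'_apply]
    simp [N, lin]
  have hMv : ∀ P x, M P *ᵥ x = B (P.space.starProjection (graphFrame Ψ X₁ x)) := by
    intro P x
    rw [← Matrix.toLin'_apply]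
    simp [M, lin]
  have hN1 : N P₁ = 1 := by
    apply Matrix.toLin'.injective
    refine LinearMap.ext fun x => ?_
    rw [Matrix.toLin'_apply, hNv, Submodule.starProjection_eq_self_iff.2]
    · simp [A, graphFrame_apply]
    · rw [hX₁, ← range_graphFrame]
      exact ⟨x, rfl⟩
  have hdet : ∀ᶠ P in nhds P₁, (N P).det ≠ 0 := by
    have hc : Continuous fun P => (N P).det := (hlin A).matrix_det
    apply hc.continuousAt.eventually_ne
    rw [hN1, Matrix.det_one]
    exact one_ne_zero
  have key : ∀ P : UManifold h, (N P).det ≠ 0 → P.space = graphSpace Ψ (M P * (N P)⁻¹) := by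
    intro P hP
    symm
    apply Submodule.eq_of_le_of_finrank_eq
    · intro v hv
      obtain ⟨x, rfl⟩ := mem_graphSpace.1 hv
      have h1 : x = N P *ᵥ ((N P)⁻¹ *ᵥ x) := by
        rw [Matrix.mulVec_mulVec, Matrix.mul_nonsing_inv _ (isUnit_iff_ne_zero.2 hP),
          Matrix.one_mulVec]
      have h2 : Ψ (x, (M P * (N P)⁻¹) *ᵥ x) =
          P.space.starProjection (graphFrame Ψ X₁ ((N P)⁻¹ *ᵥ x)) := by
        rw [← Matrix.mulVec_mulVec, hMv]
        nth_rw 1 [h1]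
        rw [hNv]
        simp [A, B]
      rw [h2]
      exact Submodule.starProjection_apply_mem _ _
    · rw [finrank_graphSpace, P.finrank_space Ψ]
  refine ⟨hdet.mono fun P hP => ⟨_, key P hP⟩, ?_⟩
  have hev : (fun P => M P * (N P)⁻¹) =ᶠ[nhds P₁] slope Ψ :=
    hdet.mono fun P hP => (slope_eq (key P hP)).symm
  refine ContinuousAt.congr ?_ hev
  have hinv : ContinuousAt (fun P => (N P)⁻¹) P₁ := by
    have : (fun P => (N P)⁻¹) = fun P => Ring.inverse (N P).det • (N P).adjugate := by
      funext P; exact Matrix.inv_def _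
    rw [this]
    simp_rw [Ring.inverse_eq_inv']
    refine ContinuousAt.smul (ContinuousAt.inv₀ (hlin A).matrix_det.continuousAt ?_)
      (hlin A).matrix_adjugate.continuousAt
    change (N P₁).det ≠ 0
    rw [hN1, Matrix.det_one]
    exact one_ne_zero
  exact ContinuousAt.mul (hlin B).continuousAt hinv

theorem isOpen_chart (Ψ : ((Fin n → ℂ) × (Fin n → ℂ)) ≃ₗ[ℂ] S) : IsOpen (chart h Ψ) :=
  isOpen_iff_mem_nhds.2 fun _ hP => (slope_continuous_aux Ψ hP).1

theorem continuousOn_slope (Ψ : ((Fin n → ℂ) × (Fin n → ℂ)) ≃ₗ[ℂ] S) :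
    ContinuousOn (slope Ψ) (chart h Ψ) :=
  fun _ hP => (slope_continuous_aux Ψ hP).2.continuousWithinAt

theorem UManifold.continuous_of_graphSpace {X : Type*} [TopologicalSpace X]
    {P : X → UManifold h} (Ψ : ((Fin n → ℂ) × (Fin n → ℂ)) ≃ₗ[ℂ] S)
    {A : X → Matrix (Fin n) (Fin n) ℂ} (hA : Continuous A)
    (hP : ∀ x, (P x).space = graphSpace Ψ (A x)) : Continuous P := by
  refine UManifold.continuous_of_frame (fun x => graphFrame Ψ (A x)) (fun v => ?_)
    (fun x => graphFrame_injective Ψ _) (fun x => by rw [hP, range_graphFrame])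
  have h1 : Continuous fun x => (v, A x *ᵥ v) :=
    continuous_const.prodMk (hA.matrix_mulVec continuous_const)
  exact (LinearMap.continuous_of_finiteDimensional
    (Ψ : ((Fin n → ℂ) × (Fin n → ℂ)) →ₗ[ℂ] S)).comp h1

end Charts

/-! ### Adapted coordinates and Hermitian graphs -/

section Adapted

variable {S : Type*} [NormedAddCommGroup S] [InnerProductSpace ℂ S] [FiniteDimensional ℂ S]
  {h : S →ₗ⋆[ℂ] S →ₗ[ℂ] ℂ}

/-- Polarization: `u + v` gives `h u v + h v u = 0`, and `u + i v` gives `h u v - h v u = 0`. -/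
theorem isotropic_apply_eq_zero {L : Submodule ℂ S} (hL : ∀ v ∈ L, h v v = 0) {u v : S}
    (hu : u ∈ L) (hv : v ∈ L) : h u v = 0 := by
  have h1 := hL _ (L.add_mem hu hv)
  have h2 := hL _ (L.add_mem hu (L.smul_mem Complex.I hv))
  simp only [map_add, LinearMap.add_apply, hL u hu, hL v hv, map_smul, LinearMap.map_smulₛₗ,
    LinearMap.smul_apply, smul_eq_mul, Complex.conj_I] at h1 h2
  have h3 : Complex.I * (2 * h u v) = 0 := by linear_combination h2 + Complex.I * h1
  have h4 := (mul_eq_zero.1 h3).resolve_left Complex.I_ne_zero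
  exact (mul_eq_zero.1 h4).resolve_left two_ne_zero

/-- A superlagrangian subspace has a superlagrangian complement in duality with it. -/
theorem exists_isAdapted (hh : IsSuperhermitian h) (P₀ : UManifold h) :
    ∃ (n : ℕ) (Φ : ((Fin n → ℂ) × (Fin n → ℂ)) ≃ₗ[ℂ] S), IsAdapted P₀ Φ := by
  have hsymm : ∀ x y, conj (h x y) = h y x := fun x y => hh.symm.eq x y
  obtain ⟨hdim, hiso⟩ := P₀.2
  let n := Module.finrank ℂ P₀.space
  let e : (Fin n → ℂ) ≃ₗ[ℂ] P₀.space := (Module.finBasis ℂ P₀.space).equivFun.symm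
  let E : (Fin n → ℂ) →ₗ[ℂ] S := P₀.space.subtype ∘ₗ (e : (Fin n → ℂ) →ₗ[ℂ] P₀.space)
  have hEmem : ∀ x, E x ∈ P₀.space := fun x => (e x).2
  have hEinj : Function.Injective E := Subtype.val_injective.comp e.injective
  -- `g` records the pairing with a basis of `P₀`. It vanishes on `P₀`, and a right inverse of it
  -- spans a complement dual to `P₀`.
  let g : S →ₗ[ℂ] (Fin n → ℂ) := LinearMap.pi fun i => h (E (Pi.single i 1))
  have hsum : ∀ (x : Fin n → ℂ) (T : (Fin n → ℂ) →ₗ[ℂ] S) (v : S),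
      h (T x) v = ∑ i, conj (x i) * h (T (Pi.single i 1)) v := by
    intro x T v
    conv_lhs => rw [← Finset.univ_sum_single x]
    simp only [map_sum, LinearMap.sum_apply]
    refine Finset.sum_congr rfl fun i _ => ?_
    have : (Pi.single i (x i) : Fin n → ℂ) = x i • Pi.single i 1 := by
      rw [← Pi.single_smul, smul_eq_mul, mul_one]
    rw [this, map_smul, LinearMap.map_smulₛₗ, LinearMap.smul_apply, smul_eq_mul]
  have hEg : ∀ x v, h (E x) v = ∑ i, conj (x i) * g v i := fun x v => hsum x E v
  have hgE : ∀ x, g (E x) = 0 := fun x => funext fun i =>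
    isotropic_apply_eq_zero hiso (hEmem _) (hEmem _)
  -- A functional `a` that kills the range of `g` yields the vector of `P₀` with coordinates `conj
  -- a`, which pairs to zero with all of `S` and so vanishes by nondegeneracy.
  have hgs : LinearMap.range g = ⊤ := by
    by_contra hne
    obtain ⟨a, ha0, hale⟩ := Submodule.exists_le_ker_of_lt_top _ (lt_top_iff_ne_top.2 hne)
    apply ha0
    have h1 : E (fun i => conj (a (Pi.single i 1))) = 0 := by
      apply hh.nondegenerate.1
      intro v
      rw [hEg]
      have h2 : a (g v) = 0 := hale ⟨v, rfl⟩
      rw [LinearMap.pi_apply_eq_sum_univ] at h2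
      rw [← h2]
      refine Finset.sum_congr rfl fun i _ => ?_
      rw [Complex.conj_conj, smul_eq_mul, mul_comm]
      congr 2
      ext j
      simp [Pi.single_apply, eq_comm]
    have h2 := hEinj (h1.trans (map_zero E).symm)
    ext i
    have h3 := congrFun h2 i
    simpa using h3
  obtain ⟨f, hf⟩ := LinearMap.exists_rightInverse_of_surjective g hgs
  -- The factor `i / 2` matches the standard form: `2 Re ((i / 2) ∑ conj ξₖ ηₖ) = Im ∑ ξₖ conj ηₖ`.
  let F : (Fin n → ℂ) →ₗ[ℂ] S := (Complex.I / 2) • f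
  have hgF : ∀ y, g (F y) = (Complex.I / 2) • y := fun y => by
    have : g (f y) = y := LinearMap.congr_fun hf y
    simp [F, this]
  let G : (Fin n → ℂ) →ₗ[ℂ] (Fin n → ℂ) :=
    LinearMap.pi fun i => h (F (Pi.single i 1)) ∘ₗ F
  have hFG : ∀ x y, h (F x) (F y) = ∑ i, conj (x i) * G y i := fun x y => hsum x F (F y)
  -- `G` is the Gram matrix of `h` on the range of `F`. Subtracting `i E G` makes the complement
  -- isotropic and keeps its pairing with `P₀`, since `P₀` is isotropic.
  let F' : (Fin n → ℂ) →ₗ[ℂ] S := F - Complex.I • (E ∘ₗ G)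
  have hF' : ∀ y, F' y = F y - E (Complex.I • G y) := fun y => by simp [F']
  have hgF' : ∀ y, g (F' y) = (Complex.I / 2) • y := fun y => by
    rw [hF', map_sub, hgE, hgF, sub_zero]
  have hF'0 : ∀ y, h (F' y) (F' y) = 0 := by
    intro y
    have h1 : h (E (Complex.I • G y)) (F y) = 1 / 2 * h (F y) (F y) := by
      rw [hEg, hgF, ← hsymm (F y) (F y), hFG, map_sum, Finset.mul_sum]
      refine Finset.sum_congr rfl fun i _ => ?_
      simp only [Pi.smul_apply, smul_eq_mul, map_mul, Complex.conj_I, Complex.conj_conj]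
      linear_combination (- (1 / 2) * conj (G y i) * y i) * Complex.I_mul_I
    have h2 : h (F y) (E (Complex.I • G y)) = 1 / 2 * h (F y) (F y) := by
      rw [← hsymm, h1, map_mul, hsymm, map_div₀, map_one, Complex.conj_ofNat]
    rw [hF', map_sub, map_sub, LinearMap.sub_apply, LinearMap.sub_apply, h1, h2,
      isotropic_apply_eq_zero hiso (hEmem _) (hEmem _)]
    ring
  let Φ₀ : ((Fin n → ℂ) × (Fin n → ℂ)) →ₗ[ℂ] S := E.coprod F'
  have hΦ₀ : ∀ z, Φ₀ z = E z.1 + F' z.2 := fun z => by simp [Φ₀]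
  have hinj : Function.Injective Φ₀ := by
    rw [injective_iff_map_eq_zero]
    rintro ⟨x, y⟩ hxy
    rw [hΦ₀] at hxy
    have h1 := congrArg g hxy
    simp only [map_add, hgE, hgF', zero_add, map_zero] at h1
    have hy : y = 0 := (smul_eq_zero.1 h1).resolve_left (by simp)
    simp only [hy, map_zero, add_zero] at hxy
    rw [hy, hEinj (hxy.trans (map_zero E).symm)]
    rfl
  have hfr : Module.finrank ℂ ((Fin n → ℂ) × (Fin n → ℂ)) = Module.finrank ℂ S := by
    rw [← hdim]
    simp only [Module.finrank_prod, Module.finrank_fin_fun]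
    exact (two_mul _).symm
  let Φ := LinearEquiv.ofInjectiveOfFinrankEq Φ₀ hinj hfr
  have hΦ : ∀ z, Φ z = E z.1 + F' z.2 := hΦ₀
  refine ⟨n, Φ, ⟨fun z => ?_, ?_⟩⟩
  · rw [hΦ, map_add, map_add, LinearMap.add_apply, LinearMap.add_apply, hF'0,
      isotropic_apply_eq_zero hiso (hEmem _) (hEmem _), ← hsymm (E z.1) (F' z.2), zero_add,
      add_zero, add_comm, Complex.add_conj, hEg, hgF']
    congr 1
    unfold stdForm
    rw [Complex.re_sum, Complex.im_sum, Finset.mul_sum]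
    refine Finset.sum_congr rfl fun i _ => ?_
    simp
    ring
  · ext v
    simp only [Submodule.mem_map, Submodule.mem_prod, Submodule.mem_top, Submodule.mem_bot,
      true_and, LinearEquiv.coe_coe, Prod.exists]
    constructor
    · rintro ⟨x, y, rfl, rfl⟩
      rw [hΦ]
      simpa using hEmem x
    · intro hv
      refine ⟨e.symm ⟨v, hv⟩, 0, rfl, ?_⟩
      rw [hΦ]
      simp [E]

variable {n : ℕ} {P₀ : UManifold h} {Φ : ((Fin n → ℂ) × (Fin n → ℂ)) ≃ₗ[ℂ] S}

theorem stdForm_graph (X : Matrix (Fin n) (Fin n) ℂ) (x : Fin n → ℂ) :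
    stdForm (x, X *ᵥ x) = - (star x ⬝ᵥ (X *ᵥ x)).im := by
  unfold stdForm dotProduct
  rw [Complex.im_sum, Complex.im_sum, ← Finset.sum_neg_distrib]
  refine Finset.sum_congr rfl fun i _ => ?_
  simp
  ring

theorem stdForm_swap (x y : Fin n → ℂ) : stdForm (y, x) = - stdForm (x, y) := by
  unfold stdForm
  rw [Complex.im_sum, Complex.im_sum, ← Finset.sum_neg_distrib]
  refine Finset.sum_congr rfl fun i _ => ?_
  simp
  ring

/-- Over `ℂ` an operator whose quadratic form is real is symmetric. -/
theorem isHermitian_iff_forall_im {X : Matrix (Fin n) (Fin n) ℂ} :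
    X.IsHermitian ↔ ∀ x, (star x ⬝ᵥ (X *ᵥ x)).im = 0 := by
  constructor
  · intro hX x
    exact hX.im_star_dotProduct_mulVec_self x
  · intro hX
    rw [← Matrix.isSymmetric_toEuclideanLin_iff, LinearMap.isSymmetric_iff_inner_map_self_real]
    intro v
    have h1 := hX v.ofLp
    rw [Complex.conj_eq_iff_im]
    have h2 : inner ℂ (Matrix.toEuclideanLin X v) v = conj (star v.ofLp ⬝ᵥ (X *ᵥ v.ofLp)) := by
      rw [EuclideanSpace.inner_eq_star_dotProduct, dotProduct, dotProduct, map_sum]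
      refine Finset.sum_congr rfl fun i _ => ?_
      simp [mul_comm]
    rw [h2, Complex.conj_im, h1, neg_zero]

/-- The coordinates with the two factors exchanged. -/
def swapCoord (Φ : ((Fin n → ℂ) × (Fin n → ℂ)) ≃ₗ[ℂ] S) :
    ((Fin n → ℂ) × (Fin n → ℂ)) ≃ₗ[ℂ] S :=
  (LinearEquiv.prodComm ℂ _ _).trans Φ

theorem swapCoord_apply (Φ : ((Fin n → ℂ) × (Fin n → ℂ)) ≃ₗ[ℂ] S) (x y : Fin n → ℂ) :
    swapCoord Φ (x, y) = Φ (y, x) := rfl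

namespace IsAdapted

variable (hΦ : IsAdapted P₀ Φ)
include hΦ

theorem form_eq_zero_iff (z : (Fin n → ℂ) × (Fin n → ℂ)) :
    h (Φ z) (Φ z) = 0 ↔ stdForm z = 0 := by
  rw [hΦ.isometry]
  exact Complex.ofReal_eq_zero

theorem isSuperlagrangian_graphSpace_iff {X : Matrix (Fin n) (Fin n) ℂ} :
    IsSuperlagrangian h (graphSpace Φ X) ↔ X.IsHermitian := by
  rw [isHermitian_iff_forall_im]
  constructor
  · rintro ⟨-, hv⟩ x
    have := hv _ (mem_graphSpace.2 ⟨x, rfl⟩)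
    rw [hΦ.form_eq_zero_iff, stdForm_graph] at this
    linarith
  · intro hX
    refine ⟨by rw [finrank_graphSpace, finrank_of_coordinates Φ], fun v hv => ?_⟩
    obtain ⟨x, rfl⟩ := mem_graphSpace.1 hv
    rw [hΦ.form_eq_zero_iff, stdForm_graph, hX, neg_zero]

theorem isSuperlagrangian_graphSpace_swap_iff {X : Matrix (Fin n) (Fin n) ℂ} :
    IsSuperlagrangian h (graphSpace (swapCoord Φ) X) ↔ X.IsHermitian := by
  rw [isHermitian_iff_forall_im]
  constructor
  · rintro ⟨-, hv⟩ x
    have := hv _ (mem_graphSpace.2 ⟨x, rfl⟩)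
    rw [swapCoord_apply, hΦ.form_eq_zero_iff, stdForm_swap, stdForm_graph] at this
    linarith
  · intro hX
    refine ⟨by rw [finrank_graphSpace, finrank_of_coordinates Φ], fun v hv => ?_⟩
    obtain ⟨x, rfl⟩ := mem_graphSpace.1 hv
    rw [swapCoord_apply, hΦ.form_eq_zero_iff, stdForm_swap, stdForm_graph, hX, neg_zero,
      neg_zero]

theorem isHermitian_slope {P : UManifold h} (hP : P ∈ chart h Φ) : (slope Φ P).IsHermitian := by
  rw [← hΦ.isSuperlagrangian_graphSpace_iff, ← graphSpace_slope hP]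
  exact P.2

theorem isHermitian_slope_swap {P : UManifold h} (hP : P ∈ chart h (swapCoord Φ)) :
    (slope (swapCoord Φ) P).IsHermitian := by
  rw [← hΦ.isSuperlagrangian_graphSpace_swap_iff, ← graphSpace_slope hP]
  exact P.2

theorem apply_mem_iff {x y : Fin n → ℂ} : Φ (x, y) ∈ P₀.space ↔ y = 0 := by
  rw [← hΦ.map_horizontal]
  constructor
  · rintro ⟨⟨x', y'⟩, hxy, h1⟩
    have h2 := Φ.injective h1
    simp only [Prod.mk.injEq] at h2
    rw [← h2.2]
    exact hxy.2
  · rintro rfl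
    exact ⟨(x, 0), by simp, rfl⟩

theorem mem_horizontal_iff {v : S} : v ∈ P₀.space ↔ ∃ x, Φ (x, 0) = v := by
  constructor
  · intro hv
    rw [← Φ.apply_symm_apply v] at hv ⊢
    have := (hΦ.apply_mem_iff (x := (Φ.symm v).1) (y := (Φ.symm v).2)).1 hv
    exact ⟨(Φ.symm v).1, by rw [← this]⟩
  · rintro ⟨x, rfl⟩
    exact hΦ.apply_mem_iff.2 rfl

/-- `P₀` is the vertical factor of the swapped coordinates, so being transverse to `P₀` is being a
graph there. The complement of the singular variety is thus a single chart. -/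
theorem notMem_singularSet_iff {P : UManifold h} :
    P ∉ singularSet P₀ ↔ P ∈ chart h (swapCoord Φ) := by
  have h1 : P ∈ singularSet P₀ ↔ P.space ⊓ P₀.space ≠ ⊥ := by
    change 1 ≤ Module.finrank ℂ ↥(P.space ⊓ P₀.space) ↔ _
    exact Submodule.one_le_finrank_iff
  rw [h1, not_not, Submodule.eq_bot_iff, mem_chart_iff]
  constructor
  · intro hP y hy
    have h2 := hP _ ⟨hy, hΦ.mem_horizontal_iff.2 ⟨y, rfl⟩⟩
    have h3 := (map_eq_zero_iff _ (swapCoord Φ).injective).1 h2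
    exact congrArg Prod.snd h3
  · rintro hP v ⟨hv, hv0⟩
    obtain ⟨x, rfl⟩ := hΦ.mem_horizontal_iff.1 hv0
    rw [hP x hv]
    exact map_zero Φ

theorem isOpen_compl_singularSet : IsOpen {P : UManifold h | P ∉ singularSet P₀} := by
  have : {P : UManifold h | P ∉ singularSet P₀} = chart h (swapCoord Φ) :=
    Set.ext fun P => hΦ.notMem_singularSet_iff
  rw [this]
  exact isOpen_chart _

/-- `Φ (x, X x)` lies in `P₀` exactly when `X x = 0`, so the intersection with `P₀` is a copy of
`ker X`. -/
theorem notMem_singularSet_iff_of_graphSpace {P : UManifold h} {X : Matrix (Fin n) (Fin n) ℂ}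
    (hP : P.space = graphSpace Φ X) : P ∉ singularSet P₀ ↔ X.det ≠ 0 := by
  rw [hΦ.notMem_singularSet_iff, mem_chart_iff, hP, Ne, ← Matrix.exists_mulVec_eq_zero_iff]
  push Not
  constructor
  · intro h1 v hv0 hv
    exact hv0 (h1 v (mem_graphSpace.2 ⟨v, by rw [hv]; rfl⟩))
  · intro h1 y hy
    obtain ⟨x, hx⟩ := mem_graphSpace.1 hy
    rw [swapCoord_apply] at hx
    have h2 := Φ.injective hx
    simp only [Prod.mk.injEq] at h2
    by_contra hy0
    exact h1 x (h2.1 ▸ hy0) h2.2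

theorem space_eq_graphSpace_swapCoord_inv {P : UManifold h} {X : Matrix (Fin n) (Fin n) ℂ}
    (hP : P.space = graphSpace Φ X) (hX : X.det ≠ 0) :
    P.space = graphSpace (swapCoord Φ) X⁻¹ := by
  have hu := isUnit_iff_ne_zero.2 hX
  rw [hP]
  ext v
  rw [mem_graphSpace, mem_graphSpace]
  constructor
  · rintro ⟨x, rfl⟩
    refine ⟨X *ᵥ x, ?_⟩
    rw [swapCoord_apply, Matrix.mulVec_mulVec, Matrix.nonsing_inv_mul _ hu, Matrix.one_mulVec]
  · rintro ⟨y, rfl⟩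
    refine ⟨X⁻¹ *ᵥ y, ?_⟩
    rw [swapCoord_apply, Matrix.mulVec_mulVec, Matrix.mul_nonsing_inv _ hu, Matrix.one_mulVec]

end IsAdapted

/-- The superlagrangian subspace that is the graph of a Hermitian matrix. -/
def hermitianGraph (hΦ : IsAdapted P₀ Φ) (X : selfAdjoint (Matrix (Fin n) (Fin n) ℂ)) :
    UManifold h :=
  ⟨graphSpace Φ X.1, hΦ.isSuperlagrangian_graphSpace_iff.2 X.2⟩

theorem continuous_hermitianGraph (hΦ : IsAdapted P₀ Φ) : Continuous (hermitianGraph hΦ) :=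
  UManifold.continuous_of_graphSpace Φ continuous_subtype_val fun _ => rfl

end Adapted

/-- Eigenvalues are roots of the characteristic polynomial. This finiteness makes possible the
choices of a rotation angle, of a shear, and of a path of invertible matrices. -/
theorem finite_setOf_eigenvalue {n : ℕ} (U : Matrix (Fin n) (Fin n) ℂ) :
    {μ : ℂ | ∃ x ≠ 0, U *ᵥ x = μ • x}.Finite := by
  refine (U.charpoly.roots.toFinset.finite_toSet).subset ?_
  rintro μ ⟨x, hx, hμ⟩
  simp only [Finset.mem_coe, Multiset.mem_toFinset, Polynomial.mem_roots U.charpoly_monic.ne_zero,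
    Polynomial.IsRoot.def]
  rw [Matrix.eval_charpoly, ← Matrix.exists_mulVec_eq_zero_iff]
  refine ⟨x, hx, ?_⟩
  rw [Matrix.sub_mulVec, hμ, Matrix.scalar_apply, ← Matrix.smul_one_eq_diagonal,
    Matrix.smul_mulVec, Matrix.one_mulVec, sub_self]

theorem eq_zero_of_sum_normSq {v : Fin n → ℂ}
    (hv : ∑ k, Complex.normSq (v k) = 0) : v = 0 := by
  rw [Finset.sum_eq_zero_iff_of_nonneg fun _ _ => Complex.normSq_nonneg _] at hv
  funext i
  exact Complex.normSq_eq_zero.1 (hv i (Finset.mem_univ i))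

/-! ### Unitary matrices, rotations and shears -/

section Cayley

variable {S : Type*} [NormedAddCommGroup S] [InnerProductSpace ℂ S] [FiniteDimensional ℂ S]
  {h : S →ₗ⋆[ℂ] S →ₗ[ℂ] ℂ} {n : ℕ} {P₀ : UManifold h}
  {Φ : ((Fin n → ℂ) × (Fin n → ℂ)) ≃ₗ[ℂ] S}

/-- The Cayley transform `(ξ, η) = ((w + v) / 2, (w - v) / (2i))`, with inverse
`(w, v) = (ξ + iη, ξ - iη)`. -/
def cayley (n : ℕ) : ((Fin n → ℂ) × (Fin n → ℂ)) ≃ₗ[ℂ] ((Fin n → ℂ) × (Fin n → ℂ)) where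
  toFun z := ((1 / 2 : ℂ) • (z.1 + z.2), (-Complex.I / 2) • (z.1 - z.2))
  invFun z := (z.1 + Complex.I • z.2, z.1 - Complex.I • z.2)
  map_add' z w := by ext <;> simp <;> ring
  map_smul' c z := by ext <;> simp <;> ring
  left_inv z := by
    have := Complex.I_mul_I
    ext i <;> simp
    · linear_combination (-(1 / 2) * (z.1 i - z.2 i)) * this
    · linear_combination ((1 / 2) * (z.1 i - z.2 i)) * this
  right_inv z := by
    ext i <;> simp
    · ring
    · linear_combination (-(z.2 i)) * Complex.I_mul_I

theorem cayley_symm_apply (z : (Fin n → ℂ) × (Fin n → ℂ)) :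
    (cayley n).symm z = (z.1 + Complex.I • z.2, z.1 - Complex.I • z.2) := rfl

theorem stdForm_cayley (w v : Fin n → ℂ) :
    stdForm (cayley n (w, v)) = (∑ k, Complex.normSq (w k) - ∑ k, Complex.normSq (v k)) / 4 := by
  unfold stdForm cayley
  rw [Complex.im_sum, ← Finset.sum_sub_distrib, Finset.sum_div]
  refine Finset.sum_congr rfl fun i _ => ?_
  have h2 : Complex.I / 2 = ((1 / 2 : ℝ) : ℂ) * Complex.I := by push_cast; ring
  have h3 : (1 / 2 : ℂ) = ((1 / 2 : ℝ) : ℂ) := by push_cast; ring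
  simp [Complex.normSq_apply, h2, h3, neg_div]
  ring

/-- Coordinates in which superlagrangian subspaces are the graphs of unitary matrices. -/
def cayleyCoord (Φ : ((Fin n → ℂ) × (Fin n → ℂ)) ≃ₗ[ℂ] S) :
    ((Fin n → ℂ) × (Fin n → ℂ)) ≃ₗ[ℂ] S :=
  (cayley n).trans Φ

theorem cayleyCoord_apply_add_sub (Φ : ((Fin n → ℂ) × (Fin n → ℂ)) ≃ₗ[ℂ] S)
    (x y : Fin n → ℂ) :
    cayleyCoord Φ (x + Complex.I • y, x - Complex.I • y) = Φ (x, y) := by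
  have := (cayley n).apply_symm_apply (x, y)
  rw [cayley_symm_apply] at this
  exact congrArg Φ this

/-- The determinant of the unitary matrix that corresponds to a superlagrangian subspace. -/
def unitaryDet (Φ : ((Fin n → ℂ) × (Fin n → ℂ)) ≃ₗ[ℂ] S) (P : UManifold h) : ℂ :=
  (slope (cayleyCoord Φ) P).det

namespace IsAdapted

variable (hΦ : IsAdapted P₀ Φ)
include hΦ

theorem form_cayleyCoord_eq_zero_iff (w v : Fin n → ℂ) :
    h (cayleyCoord Φ (w, v)) (cayleyCoord Φ (w, v)) = 0 ↔
      ∑ k, Complex.normSq (w k) = ∑ k, Complex.normSq (v k) := by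
  change h (Φ (cayley n (w, v))) (Φ (cayley n (w, v))) = 0 ↔ _
  rw [hΦ.form_eq_zero_iff, stdForm_cayley, div_eq_zero_iff, sub_eq_zero]
  simp

theorem sum_normSq_eq {P : UManifold h} {w v : Fin n → ℂ}
    (hP : cayleyCoord Φ (w, v) ∈ P.space) :
    ∑ k, Complex.normSq (w k) = ∑ k, Complex.normSq (v k) :=
  (hΦ.form_cayleyCoord_eq_zero_iff w v).1 (P.2.2 _ hP)

/-- Vectors `(w, v)` of a superlagrangian subspace satisfy `|w| = |v|`, so `w = 0` forces `v = 0`.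
This chart is therefore global. -/
theorem mem_chart_cayleyCoord (P : UManifold h) : P ∈ chart h (cayleyCoord Φ) := by
  rw [mem_chart_iff]
  intro y hy
  exact eq_zero_of_sum_normSq ((hΦ.sum_normSq_eq hy).symm.trans (by simp))

theorem continuous_slope_cayleyCoord :
    Continuous (slope (cayleyCoord Φ) : UManifold h → Matrix (Fin n) (Fin n) ℂ) := by
  rw [← continuousOn_univ]
  exact (continuousOn_slope (cayleyCoord Φ)).mono fun P _ => hΦ.mem_chart_cayleyCoord P

theorem slope_cayleyCoord_mulVec {P : UManifold h} {x y : Fin n → ℂ}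
    (hP : Φ (x, y) ∈ P.space) :
    slope (cayleyCoord Φ) P *ᵥ (x + Complex.I • y) = x - Complex.I • y := by
  rw [← cayleyCoord_apply_add_sub, graphSpace_slope (hΦ.mem_chart_cayleyCoord P),
    mem_graphSpace] at hP
  obtain ⟨w, hw⟩ := hP
  have h1 := (cayleyCoord Φ).injective hw
  simp only [Prod.mk.injEq] at h1
  rw [← h1.1, h1.2]

theorem continuous_unitaryDet : Continuous (unitaryDet Φ : UManifold h → ℂ) :=
  hΦ.continuous_slope_cayleyCoord.matrix_det

theorem unitaryDet_ne_zero (P : UManifold h) : unitaryDet Φ P ≠ 0 := by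
  unfold unitaryDet
  rw [Ne, ← Matrix.exists_mulVec_eq_zero_iff]
  rintro ⟨w, hw0, hw⟩
  apply hw0
  have h1 : cayleyCoord Φ (w, 0) ∈ P.space := by
    rw [graphSpace_slope (hΦ.mem_chart_cayleyCoord P)]
    exact mem_graphSpace.2 ⟨w, by rw [hw]⟩
  exact eq_zero_of_sum_normSq ((hΦ.sum_normSq_eq h1).trans (by simp))

theorem unitaryDet_mul_of_graphSpace {P : UManifold h} {X : Matrix (Fin n) (Fin n) ℂ}
    (hP : P.space = graphSpace Φ X) :
    unitaryDet Φ P * (1 + Complex.I • X).det = (1 - Complex.I • X).det := by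
  unfold unitaryDet
  rw [← Matrix.det_mul]
  congr 1
  apply Matrix.toLin'.injective
  refine LinearMap.ext fun x => ?_
  have h1 := hΦ.slope_cayleyCoord_mulVec (P := P) (x := x) (y := X *ᵥ x)
    (hP ▸ mem_graphSpace.2 ⟨x, rfl⟩)
  rw [Matrix.toLin'_apply, Matrix.toLin'_apply, ← Matrix.mulVec_mulVec, Matrix.add_mulVec,
    Matrix.sub_mulVec, Matrix.one_mulVec, Matrix.smul_mulVec, h1]

theorem unitaryDet_mul_of_graphSpace_swap {P : UManifold h} {X : Matrix (Fin n) (Fin n) ℂ}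
    (hP : P.space = graphSpace (swapCoord Φ) X) :
    unitaryDet Φ P * (X + Complex.I • 1).det = (X - Complex.I • 1).det := by
  unfold unitaryDet
  rw [← Matrix.det_mul]
  congr 1
  apply Matrix.toLin'.injective
  refine LinearMap.ext fun x => ?_
  have h1 := hΦ.slope_cayleyCoord_mulVec (P := P) (x := X *ᵥ x) (y := x)
    (hP ▸ mem_graphSpace.2 ⟨x, rfl⟩)
  rw [Matrix.toLin'_apply, Matrix.toLin'_apply, ← Matrix.mulVec_mulVec, Matrix.add_mulVec,
    Matrix.sub_mulVec, Matrix.smul_mulVec, Matrix.one_mulVec, h1]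

theorem isSuperlagrangian_rotate (z : Circle) (P : UManifold h) :
    IsSuperlagrangian h
      (graphSpace (cayleyCoord Φ) ((z : ℂ) • slope (cayleyCoord Φ) P)) := by
  refine ⟨by rw [finrank_graphSpace, finrank_of_coordinates Φ], fun v hv => ?_⟩
  obtain ⟨w, rfl⟩ := mem_graphSpace.1 hv
  rw [hΦ.form_cayleyCoord_eq_zero_iff, hΦ.sum_normSq_eq (P := P) (w := w)
    (v := slope (cayleyCoord Φ) P *ᵥ w)]
  · refine Finset.sum_congr rfl fun k _ => ?_
    rw [Matrix.smul_mulVec, Pi.smul_apply, smul_eq_mul, Complex.normSq_mul, Circle.normSq_coe,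
      one_mul]
  · rw [graphSpace_slope (hΦ.mem_chart_cayleyCoord P)]
    exact mem_graphSpace.2 ⟨w, rfl⟩

end IsAdapted

/-- The action of the circle on the `U`-manifold by multiplication of unitary matrices. -/
def rotate (hΦ : IsAdapted P₀ Φ) (z : Circle) (P : UManifold h) : UManifold h :=
  ⟨_, hΦ.isSuperlagrangian_rotate z P⟩

theorem continuous_rotate (hΦ : IsAdapted P₀ Φ) :
    Continuous fun q : Circle × UManifold h => rotate hΦ q.1 q.2 :=
  UManifold.continuous_of_graphSpace (cayleyCoord Φ)
    (A := fun q : Circle × UManifold h => (q.1 : ℂ) • slope (cayleyCoord Φ) q.2)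
    ((continuous_subtype_val.comp continuous_fst).smul
      (hΦ.continuous_slope_cayleyCoord.comp continuous_snd)) fun _ => rfl

theorem rotate_one (hΦ : IsAdapted P₀ Φ) (P : UManifold h) : rotate hΦ 1 P = P := by
  apply UManifold.ext
  rw [graphSpace_slope (hΦ.mem_chart_cayleyCoord P)]
  change graphSpace _ _ = _
  rw [Circle.coe_one, one_smul]

/-- `z U` fixes a nonzero vector only if `z⁻¹` is an eigenvalue of `U`. -/
theorem finite_rotate_mem_singularSet (hΦ : IsAdapted P₀ Φ) (P : UManifold h) :
    {z : Circle | rotate hΦ z P ∈ singularSet P₀}.Finite := by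
  refine ((finite_setOf_eigenvalue (slope (cayleyCoord Φ) P)).preimage
    (f := fun z : Circle => ((z⁻¹ : Circle) : ℂ)) ?_).subset ?_
  · exact fun a _ b _ hab => inv_injective (Circle.ext hab)
  · intro z hz
    by_contra hne
    apply (hΦ.notMem_singularSet_iff.2 ?_) hz
    rw [mem_chart_iff]
    intro y hy
    by_contra hy0
    apply hne
    refine ⟨y, hy0, ?_⟩
    have h1 : cayleyCoord Φ (y, y) ∈ graphSpace (cayleyCoord Φ)
        ((z : ℂ) • slope (cayleyCoord Φ) P) := by
      have h2 := cayleyCoord_apply_add_sub Φ y 0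
      simp only [smul_zero, add_zero, sub_zero] at h2
      rw [h2]
      exact hy
    obtain ⟨w, hw⟩ := mem_graphSpace.1 h1
    have h3 := (cayleyCoord Φ).injective hw
    simp only [Prod.mk.injEq] at h3
    obtain ⟨rfl, h4⟩ := h3
    conv_rhs => rw [← h4]
    rw [Matrix.smul_mulVec, smul_smul, ← Circle.coe_mul, inv_mul_cancel, Circle.coe_one, one_smul]

/-- The shear `(x, y) ↦ (x + c y, y)`. -/
def shear (n : ℕ) (c : ℝ) :
    ((Fin n → ℂ) × (Fin n → ℂ)) ≃ₗ[ℂ] ((Fin n → ℂ) × (Fin n → ℂ)) where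
  toFun z := (z.1 + (c : ℂ) • z.2, z.2)
  invFun z := (z.1 - (c : ℂ) • z.2, z.2)
  map_add' z w := by ext <;> simp; ring
  map_smul' c z := by ext <;> simp; ring
  left_inv z := by simp
  right_inv z := by simp

theorem shear_apply (c : ℝ) (z : (Fin n → ℂ) × (Fin n → ℂ)) :
    shear n c z = (z.1 + (c : ℂ) • z.2, z.2) := rfl

theorem IsAdapted.shear (hΦ : IsAdapted P₀ Φ) (c : ℝ) :
    IsAdapted P₀ ((shear n c).trans Φ) := by
  constructor
  · intro z
    rw [LinearEquiv.trans_apply, hΦ.isometry]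
    congr 1
    unfold stdForm
    rw [Complex.im_sum, Complex.im_sum]
    refine Finset.sum_congr rfl fun i _ => ?_
    simp [shear_apply]
    ring
  · rw [← hΦ.map_horizontal]
    ext v
    simp only [Submodule.mem_map, Submodule.mem_prod, Submodule.mem_top, Submodule.mem_bot,
      true_and, LinearEquiv.coe_coe, Prod.exists, LinearEquiv.trans_apply, shear_apply]
    constructor
    · rintro ⟨x, y, rfl, rfl⟩
      exact ⟨x, 0, rfl, by simp⟩
    · rintro ⟨x, y, rfl, rfl⟩
      exact ⟨x, 0, rfl, by simp⟩

/-- Every superlagrangian subspace is transverse to one of the complements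
`{(c y, y)}` of `P₀`. -/
theorem exists_mem_chart_shear (hΦ : IsAdapted P₀ Φ) (P : UManifold h) :
    ∃ c : ℝ, P ∈ chart h ((shear n c).trans Φ) := by
  have hne : ∀ c : ℝ, (c : ℂ) + Complex.I ≠ 0 := fun c hc => by
    have := congrArg Complex.im hc
    simp at this
  -- `Φ (c y, y) ∈ P` means `U ((c + i) y) = (c - i) y`. A bad `c` thus makes `(c - i) / (c + i)` an
  -- eigenvalue of `U`, and distinct `c` give distinct values, so only finitely many `c` are bad.
  have hinj : Function.Injective fun c : ℝ => ((c : ℂ) - Complex.I) / (c + Complex.I) := by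
    intro c d hcd
    simp only at hcd
    rw [div_eq_div_iff (hne c) (hne d)] at hcd
    have h1 : 2 * Complex.I * ((c : ℂ) - d) = 0 := by linear_combination hcd
    have h2 := (mul_eq_zero.1 h1).resolve_left (by simp)
    exact Complex.ofReal_injective (sub_eq_zero.1 h2)
  obtain ⟨c, hc⟩ := ((finite_setOf_eigenvalue (slope (cayleyCoord Φ) P)).preimage
    hinj.injOn).exists_notMem
  refine ⟨c, mem_chart_iff.2 fun y hy => ?_⟩
  by_contra hy0
  apply hc
  refine ⟨y, hy0, ?_⟩
  change _ = (((c : ℂ) - Complex.I) / (c + Complex.I)) • y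
  rw [LinearEquiv.trans_apply, shear_apply] at hy
  have h1 := hΦ.slope_cayleyCoord_mulVec hy
  simp only [zero_add] at h1
  rw [← add_smul, ← sub_smul, Matrix.mulVec_smul] at h1
  rw [div_eq_inv_mul, mul_smul, ← h1, smul_smul, inv_mul_cancel₀ (hne c), one_smul]

end Cayley

/-! ### Arguments of determinants of Hermitian pencils -/

section ArctanTrace

variable {n : ℕ} {A : Matrix (Fin n) (Fin n) ℂ}

theorem trace_cfc (hA : A.IsHermitian) (f : ℝ → ℝ) :
    (cfc f A).trace = ∑ i, (f (hA.eigenvalues i) : ℂ) := by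
  rw [hA.cfc_eq, Matrix.IsHermitian.cfc, Unitary.conjStarAlgAut_apply, Matrix.trace_mul_comm,
    ← mul_assoc, Unitary.coe_star_mul_self, one_mul, Matrix.trace_diagonal]
  rfl

/-- The sum of the arctangents of the eigenvalues of a Hermitian matrix. -/
def arctanTrace (A : Matrix (Fin n) (Fin n) ℂ) : ℝ := (cfc Real.arctan A).trace.re

theorem arctanTrace_eq (hA : A.IsHermitian) :
    arctanTrace A = ∑ i, Real.arctan (hA.eigenvalues i) := by
  unfold arctanTrace
  rw [trace_cfc hA, ← Complex.ofReal_sum, Complex.ofReal_re]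

-- The functional calculus gives continuity without any continuous choice of eigenvalues.
open scoped Matrix.Norms.L2Operator in
theorem continuous_arctanTrace :
    Continuous fun X : selfAdjoint (Matrix (Fin n) (Fin n) ℂ) => arctanTrace X.1 := by
  have h1 : Continuous fun X : selfAdjoint (Matrix (Fin n) (Fin n) ℂ) => cfc Real.arctan X.1 :=
    Continuous.cfc_of_mem_nhdsSet (s := Set.univ) Real.arctan Filter.univ_mem
      continuous_subtype_val (fun X => X.2) Real.continuous_arctan.continuousOn
  exact Complex.continuous_re.comp h1.matrix_trace

theorem eigenvalues_ne_zero (hA : A.IsHermitian) (hdet : A.det ≠ 0) (i : Fin n) :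
    hA.eigenvalues i ≠ 0 := by
  intro hi
  apply hdet
  rw [hA.det_eq_prod_eigenvalues, Finset.prod_eq_zero (Finset.mem_univ i)]
  rw [hi]
  simp

theorem arctan_add_arctan_inv {x : ℝ} (hx : x ≠ 0) :
    Real.arctan x + Real.arctan x⁻¹ =
      Real.pi / 2 * ((if 0 < x then 1 else 0) - (if x < 0 then 1 else 0)) := by
  rcases lt_or_gt_of_ne hx with h | h
  · rw [Real.arctan_inv_of_neg h, if_neg h.not_gt, if_pos h]
    ring
  · rw [Real.arctan_inv_of_pos h, if_pos h, if_neg h.not_gt]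
    ring

/-- Each eigenvalue contributes `arctan x + arctan x⁻¹`, which is `π / 2` times the sign of `x`.
This is how the signature enters the index. -/
theorem arctanTrace_add_arctanTrace_inv (hA : A.IsHermitian) (hdet : A.det ≠ 0) :
    arctanTrace A + arctanTrace A⁻¹ = Real.pi / 2 * matrixSign hA := by
  have hinv : cfc (fun x : ℝ => x⁻¹) A = A⁻¹ := by
    obtain ⟨u, rfl⟩ := (Matrix.isUnit_iff_isUnit_det A).2 (isUnit_iff_ne_zero.2 hdet)
    rw [← Matrix.coe_units_inv]
    exact cfc_inv_id u hA
  have hcomp : cfc Real.arctan A⁻¹ = cfc (fun x : ℝ => Real.arctan x⁻¹) A := by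
    rw [← hinv]
    exact (cfc_comp' Real.arctan (fun x : ℝ => x⁻¹) A Real.continuous_arctan.continuousOn
      (A.finite_real_spectrum.continuousOn _) hA).symm
  rw [arctanTrace_eq hA, arctanTrace, hcomp, trace_cfc hA, ← Complex.ofReal_sum,
    Complex.ofReal_re, ← Finset.sum_add_distrib,
    Finset.sum_congr rfl fun i _ => arctan_add_arctan_inv (eigenvalues_ne_zero hA hdet i),
    ← Finset.mul_sum, Finset.sum_sub_distrib]
  unfold matrixSign
  congr 1
  push_cast
  rw [Fintype.card_subtype, Fintype.card_subtype, Finset.card_filter, Finset.card_filter]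
  push_cast
  rfl

theorem det_smul_one_add_smul (hA : A.IsHermitian) (a b : ℂ) :
    (a • (1 : Matrix (Fin n) (Fin n) ℂ) + b • A).det = ∏ i, (a + b * hA.eigenvalues i) := by
  have h1 : a • (1 : Matrix (Fin n) (Fin n) ℂ) + b • A =
      (hA.eigenvectorUnitary : Matrix (Fin n) (Fin n) ℂ) *
        Matrix.diagonal (fun i => a + b * hA.eigenvalues i) *
        (star hA.eigenvectorUnitary : Matrix (Fin n) (Fin n) ℂ) := by
    have h2 : Matrix.diagonal (fun i => a + b * (hA.eigenvalues i : ℂ)) =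
        a • (1 : Matrix (Fin n) (Fin n) ℂ) +
          b • Matrix.diagonal (fun i => (hA.eigenvalues i : ℂ)) := by
      rw [Matrix.smul_one_eq_diagonal, ← Matrix.diagonal_smul, Matrix.diagonal_add]
      rfl
    have h3 := hA.spectral_theorem
    rw [Unitary.conjStarAlgAut_apply] at h3
    rw [h2, mul_add, add_mul, mul_smul_comm, mul_one, smul_mul_assoc, mul_smul_comm,
      smul_mul_assoc]
    congr 2
    · exact (Unitary.coe_mul_star_self _).symm
  rw [h1, Matrix.det_mul, Matrix.det_mul, mul_right_comm, ← Matrix.det_mul,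
    show (hA.eigenvectorUnitary : Matrix (Fin n) (Fin n) ℂ) * star ↑hA.eigenvectorUnitary = 1 from
      Unitary.coe_mul_star_self _, Matrix.det_one, one_mul, Matrix.det_diagonal]

theorem one_add_I_mul (x : ℝ) :
    1 + Complex.I * x = Real.sqrt (1 + x ^ 2) * Complex.exp (Complex.I * Real.arctan x) := by
  have h0 : Real.sqrt (1 + x ^ 2) ≠ 0 := by positivity
  rw [mul_comm Complex.I (Real.arctan x : ℂ), Complex.exp_mul_I, ← Complex.ofReal_cos,
    ← Complex.ofReal_sin, Real.cos_arctan, Real.sin_arctan]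
  push_cast
  have h1 : ((Real.sqrt (1 + x ^ 2) : ℝ) : ℂ) ≠ 0 := by exact_mod_cast h0
  field_simp

theorem one_sub_I_mul (x : ℝ) :
    1 - Complex.I * x = Real.sqrt (1 + x ^ 2) * Complex.exp (-(Complex.I * Real.arctan x)) := by
  have h1 := one_add_I_mul (-x)
  rw [Real.arctan_neg, neg_sq] at h1
  push_cast [-Complex.ofReal_arctan] at h1
  rw [mul_neg, mul_neg, ← sub_eq_add_neg] at h1
  exact h1

theorem one_add_I_mul_ne_zero (x : ℝ) : 1 + Complex.I * x ≠ 0 := fun h => by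
  have := congrArg Complex.re h
  simp at this

theorem det_one_add_I_smul_ne_zero (hA : A.IsHermitian) : (1 + Complex.I • A).det ≠ 0 := by
  rw [← one_smul ℂ (1 : Matrix (Fin n) (Fin n) ℂ), det_smul_one_add_smul hA,
    Finset.prod_ne_zero_iff]
  exact fun i _ => one_add_I_mul_ne_zero _

/-- For each eigenvalue, `(1 - i x) / (1 + i x) = exp (-2 i arctan x)`. -/
theorem det_one_sub_I_smul (hA : A.IsHermitian) :
    (1 - Complex.I • A).det =
      Complex.exp (Complex.I * (-2 * arctanTrace A : ℝ)) * (1 + Complex.I • A).det := by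
  rw [sub_eq_add_neg, ← neg_smul, ← one_smul ℂ (1 : Matrix (Fin n) (Fin n) ℂ),
    det_smul_one_add_smul hA, det_smul_one_add_smul hA, arctanTrace_eq hA, Finset.mul_sum]
  push_cast [-Complex.ofReal_arctan]
  rw [Finset.mul_sum, Complex.exp_sum, ← Finset.prod_mul_distrib]
  refine Finset.prod_congr rfl fun i _ => ?_
  rw [neg_mul, ← sub_eq_add_neg, one_sub_I_mul, one_add_I_mul, mul_left_comm, ← Complex.exp_add]
  congr 2
  ring

theorem det_add_I_smul_one_ne_zero (hA : A.IsHermitian) : (A + Complex.I • 1).det ≠ 0 := by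
  rw [add_comm, ← one_smul ℂ A, det_smul_one_add_smul hA, Finset.prod_ne_zero_iff]
  intro i _ h
  have := congrArg Complex.im h
  simp at this

/-- For each eigenvalue, `(x - i) / (x + i) = -(1 + i x) / (1 - i x) = exp (i (π + 2 arctan x))`.
The `n` signs account for the term `n π`. -/
theorem det_sub_I_smul_one (hA : A.IsHermitian) :
    (A - Complex.I • 1).det =
      Complex.exp (Complex.I * (n * Real.pi + 2 * arctanTrace A : ℝ)) *
        (A + Complex.I • 1).det := by
  rw [sub_eq_add_neg, ← neg_smul, add_comm, add_comm A, ← one_smul ℂ A,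
    det_smul_one_add_smul hA, det_smul_one_add_smul hA, one_smul, arctanTrace_eq hA]
  have h1 : (n * Real.pi + 2 * ∑ i, Real.arctan (hA.eigenvalues i) : ℝ) =
      ∑ i, (Real.pi + 2 * Real.arctan (hA.eigenvalues i)) := by
    rw [Finset.sum_add_distrib, ← Finset.mul_sum]
    simp
  rw [h1]
  push_cast [-Complex.ofReal_arctan]
  rw [Finset.mul_sum, Complex.exp_sum, ← Finset.prod_mul_distrib]
  refine Finset.prod_congr rfl fun i _ => ?_
  have h2 : -Complex.I + 1 * (hA.eigenvalues i : ℂ) =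
      -Complex.I * (1 + Complex.I * hA.eigenvalues i) := by
    linear_combination ((hA.eigenvalues i : ℂ)) * Complex.I_mul_I
  have h3 : Complex.I + 1 * (hA.eigenvalues i : ℂ) =
      Complex.I * (1 - Complex.I * hA.eigenvalues i) := by
    linear_combination ((hA.eigenvalues i : ℂ)) * Complex.I_mul_I
  rw [h2, h3, one_sub_I_mul, one_add_I_mul, mul_add, Complex.exp_add,
    mul_comm Complex.I (Real.pi : ℂ), Complex.exp_pi_mul_I]
  have h4 : Complex.exp (Complex.I * (2 * Real.arctan (hA.eigenvalues i))) *
      Complex.exp (-(Complex.I * Real.arctan (hA.eigenvalues i))) =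
      Complex.exp (Complex.I * Real.arctan (hA.eigenvalues i)) := by
    rw [← Complex.exp_add]
    congr 1
    ring
  linear_combination (Complex.I * (Real.sqrt (1 + hA.eigenvalues i ^ 2) : ℂ)) * h4

end ArctanTrace

/-! ### Deformation of adapted coordinate systems -/

theorem stdForm_eq_im_dotProduct {n : ℕ} (x y : Fin n → ℂ) :
    stdForm (x, y) = (star y ⬝ᵥ x).im := by
  unfold stdForm dotProduct
  congr 1
  exact Finset.sum_congr rfl fun i _ => mul_comm _ _

/-- The general linear group over `ℂ` is path connected. -/
theorem exists_path_det_ne_zero {n : ℕ} (A : Matrix (Fin n) (Fin n) ℂ) (hA : A.det ≠ 0) :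
    ∃ γ : unitInterval → Matrix (Fin n) (Fin n) ℂ, Continuous γ ∧ γ 0 = 1 ∧ γ 1 = A ∧
      ∀ s, (γ s).det ≠ 0 := by
  -- The determinant of `1 + z (A - 1)` can vanish on the real segment from `0` to `1`, but only at
  -- finitely many complex `z`, and a path in `ℂ` goes around them.
  have hfin : {z : ℂ | (1 + z • (A - 1)).det = 0}.Finite := by
    refine ((finite_setOf_eigenvalue (A - 1)).preimage (f := fun z : ℂ => -z⁻¹) ?_).subset ?_
    · exact (neg_injective.comp inv_injective).injOn
    · intro z hz
      obtain ⟨x, hx, hxz⟩ := Matrix.exists_mulVec_eq_zero_iff.2 hz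
      refine ⟨x, hx, ?_⟩
      change _ = (-z⁻¹) • x
      rw [Matrix.add_mulVec, Matrix.one_mulVec, Matrix.smul_mulVec] at hxz
      have hz0 : z ≠ 0 := by
        rintro rfl
        rw [zero_smul, add_zero] at hxz
        exact hx hxz
      have h1 : x = -(z • ((A - 1) *ᵥ x)) := eq_neg_of_add_eq_zero_left hxz
      conv_rhs => rw [h1]
      rw [smul_neg, neg_smul, neg_neg, smul_smul, inv_mul_cancel₀ hz0, one_smul]
  have hconn := hfin.countable.isPathConnected_compl_of_one_lt_rank
    (by rw [Complex.rank_real_complex]; norm_num)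
  obtain ⟨γ, hγ⟩ := hconn.joinedIn 0 (by simp) 1 (by simpa using hA)
  refine ⟨fun s => 1 + γ s • (A - 1), by fun_prop, by simp, by simp, fun s => hγ s⟩

section AdaptedPath

variable {S : Type*} [NormedAddCommGroup S] [InnerProductSpace ℂ S] [FiniteDimensional ℂ S]
  {h : S →ₗ⋆[ℂ] S →ₗ[ℂ] ℂ} {n : ℕ} {P₀ : UManifold h}
  {Φ Φ' : ((Fin n → ℂ) × (Fin n → ℂ)) ≃ₗ[ℂ] S}

/-- The block triangular transformation `(x, y) ↦ (A (x + C y), A⁻ᴴ y)`. -/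
def blockEquiv (A C : Matrix (Fin n) (Fin n) ℂ) (hA : A.det ≠ 0) :
    ((Fin n → ℂ) × (Fin n → ℂ)) ≃ₗ[ℂ] ((Fin n → ℂ) × (Fin n → ℂ)) where
  toFun z := (A *ᵥ (z.1 + C *ᵥ z.2), (A⁻¹)ᴴ *ᵥ z.2)
  invFun z := (A⁻¹ *ᵥ z.1 - C *ᵥ (Aᴴ *ᵥ z.2), Aᴴ *ᵥ z.2)
  map_add' z w := by
    ext1
    · simp only [Prod.fst_add, Prod.snd_add, Matrix.mulVec_add]
      abel
    · simp only [Prod.snd_add, Matrix.mulVec_add]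
  map_smul' c z := by
    ext1
    · simp only [Prod.smul_fst, Prod.smul_snd, Matrix.mulVec_smul, ← smul_add, RingHom.id_apply]
    · simp only [Prod.smul_snd, Matrix.mulVec_smul, RingHom.id_apply]
  left_inv z := by
    have h1 : Aᴴ * (A⁻¹)ᴴ = 1 := by
      rw [← Matrix.conjTranspose_mul, Matrix.nonsing_inv_mul _ (isUnit_iff_ne_zero.2 hA),
        Matrix.conjTranspose_one]
    ext1
    · simp [Matrix.mulVec_mulVec, h1, Matrix.nonsing_inv_mul _ (isUnit_iff_ne_zero.2 hA)]
    · simp [Matrix.mulVec_mulVec, h1]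
  right_inv z := by
    have h1 : (A⁻¹)ᴴ * Aᴴ = 1 := by
      rw [← Matrix.conjTranspose_mul, Matrix.mul_nonsing_inv _ (isUnit_iff_ne_zero.2 hA),
        Matrix.conjTranspose_one]
    ext1
    · simp [Matrix.mulVec_mulVec, Matrix.mul_nonsing_inv _ (isUnit_iff_ne_zero.2 hA)]
    · simp [Matrix.mulVec_mulVec, h1]

theorem blockEquiv_apply (A C : Matrix (Fin n) (Fin n) ℂ) (hA : A.det ≠ 0)
    (z : (Fin n → ℂ) × (Fin n → ℂ)) :
    blockEquiv A C hA z = (A *ᵥ (z.1 + C *ᵥ z.2), (A⁻¹)ᴴ *ᵥ z.2) := rfl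

theorem star_mulVec_dotProduct_mulVec (A B : Matrix (Fin n) (Fin n) ℂ) (x y : Fin n → ℂ) :
    star (A *ᵥ y) ⬝ᵥ (B *ᵥ x) = star y ⬝ᵥ ((Aᴴ * B) *ᵥ x) := by
  rw [Matrix.star_mulVec, Matrix.dotProduct_mulVec, Matrix.vecMul_vecMul,
    ← Matrix.dotProduct_mulVec]

/-- In the form, `A` and `A⁻ᴴ` cancel, and `C` contributes only `Im ⟨C y, y⟩`, which vanishes for
Hermitian `C`. -/
theorem IsAdapted.blockEquiv (hΦ : IsAdapted P₀ Φ) (A C : Matrix (Fin n) (Fin n) ℂ)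
    (hA : A.det ≠ 0) (hC : C.IsHermitian) :
    IsAdapted P₀ ((EdwardsMaslov.blockEquiv A C hA).trans Φ) := by
  have hu := isUnit_iff_ne_zero.2 hA
  constructor
  · rintro ⟨x, y⟩
    rw [LinearEquiv.trans_apply, hΦ.isometry, blockEquiv_apply, stdForm_eq_im_dotProduct,
      stdForm_eq_im_dotProduct, star_mulVec_dotProduct_mulVec, Matrix.conjTranspose_conjTranspose,
      Matrix.nonsing_inv_mul _ hu, Matrix.one_mulVec, dotProduct_add, Complex.add_im,
      isHermitian_iff_forall_im.1 hC, add_zero]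
  · rw [← hΦ.map_horizontal]
    ext v
    simp only [Submodule.mem_map, Submodule.mem_prod, Submodule.mem_top, Submodule.mem_bot,
      true_and, LinearEquiv.coe_coe, Prod.exists, LinearEquiv.trans_apply, blockEquiv_apply]
    constructor
    · rintro ⟨x, y, rfl, rfl⟩
      exact ⟨A *ᵥ x, 0, rfl, by simp⟩
    · rintro ⟨x, y, rfl, rfl⟩
      exact ⟨A⁻¹ *ᵥ x, 0, rfl, by simp [Matrix.mulVec_mulVec, Matrix.mul_nonsing_inv _ hu]⟩

-- Replacing `x` by `i x` turns imaginary parts into real parts, so `A x - x` is orthogonal to every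
-- `y`, in particular to itself.
open scoped ComplexOrder in
theorem eq_of_forall_im_dotProduct {A : Matrix (Fin n) (Fin n) ℂ}
    (hA : ∀ x y : Fin n → ℂ, (star y ⬝ᵥ (A *ᵥ x)).im = (star y ⬝ᵥ x).im) : A = 1 := by
  apply Matrix.toLin'.injective
  refine LinearMap.ext fun x => ?_
  rw [Matrix.toLin'_apply, Matrix.toLin'_one, LinearMap.id_apply, ← sub_eq_zero]
  apply dotProduct_star_self_eq_zero.1
  set y := A *ᵥ x - x
  apply Complex.ext
  · have h1 := hA (Complex.I • x) y
    rw [Matrix.mulVec_smul, dotProduct_smul, dotProduct_smul] at h1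
    simp only [smul_eq_mul, Complex.mul_im, Complex.I_re, Complex.I_im, zero_mul, one_mul,
      zero_add] at h1
    change (star y ⬝ᵥ (A *ᵥ x - x)).re = 0
    rw [dotProduct_sub, Complex.sub_re, h1, sub_self]
  · change (star y ⬝ᵥ (A *ᵥ x - x)).im = 0
    rw [dotProduct_sub, Complex.sub_im, hA, sub_self]

/-- Two adapted coordinate systems differ by a block triangular transformation. -/
theorem exists_blockEquiv (hΦ : IsAdapted P₀ Φ) (hΦ' : IsAdapted P₀ Φ') :
    ∃ (A C : Matrix (Fin n) (Fin n) ℂ) (hA : A.det ≠ 0), C.IsHermitian ∧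
      Φ' = (blockEquiv A C hA).trans Φ := by
  let T : ((Fin n → ℂ) × (Fin n → ℂ)) →ₗ[ℂ] ((Fin n → ℂ) × (Fin n → ℂ)) :=
    (Φ.symm : S →ₗ[ℂ] _) ∘ₗ (Φ' : _ →ₗ[ℂ] S)
  have hT : ∀ z, Φ (T z) = Φ' z := fun z => Φ.apply_symm_apply _
  let A := LinearMap.toMatrix' (LinearMap.fst ℂ _ _ ∘ₗ T ∘ₗ LinearMap.inl ℂ _ _)
  let B := LinearMap.toMatrix' (LinearMap.fst ℂ _ _ ∘ₗ T ∘ₗ LinearMap.inr ℂ _ _)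
  let D := LinearMap.toMatrix' (LinearMap.snd ℂ _ _ ∘ₗ T ∘ₗ LinearMap.inr ℂ _ _)
  -- Both systems send the horizontal factor to `P₀`, so the transition map is block upper
  -- triangular.
  have hTz : ∀ x y, T (x, y) = (A *ᵥ x + B *ᵥ y, D *ᵥ y) := by
    intro x y
    have h1 : (T (x, 0)).2 = 0 := by
      rw [← hΦ.apply_mem_iff (x := (T (x, 0)).1), Prod.mk.eta, hT, hΦ'.apply_mem_iff]
    have h2 : T (x, y) = T (x, 0) + T (0, y) := by rw [← map_add]; simp
    rw [h2]
    ext1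
    · simp [A, B, ← Matrix.toLin'_apply]
    · rw [Prod.snd_add, h1, zero_add]
      simp [D, ← Matrix.toLin'_apply]
  -- Invariance of the form: `x = 0` shows that `Dᴴ B` is Hermitian, and the remaining mixed term
  -- then gives `Dᴴ A = 1`.
  have hform : ∀ x y, (star (D *ᵥ y) ⬝ᵥ (A *ᵥ x + B *ᵥ y)).im = (star y ⬝ᵥ x).im := by
    intro x y
    rw [← stdForm_eq_im_dotProduct, ← stdForm_eq_im_dotProduct, ← hTz]
    have h1 := hΦ.isometry (T (x, y))
    rw [hT, hΦ'.isometry] at h1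
    exact (Complex.ofReal_injective h1).symm
  have hBD : ∀ y, (star (D *ᵥ y) ⬝ᵥ (B *ᵥ y)).im = 0 := by
    intro y
    have := hform 0 y
    simpa using this
  have hDA : Dᴴ * A = 1 := by
    apply eq_of_forall_im_dotProduct
    intro x y
    rw [← star_mulVec_dotProduct_mulVec, ← hform x y, dotProduct_add, Complex.add_im, hBD,
      add_zero]
  have hA : A.det ≠ 0 := by
    intro h0
    have := congrArg Matrix.det hDA
    rw [Matrix.det_mul, h0, mul_zero, Matrix.det_one] at this
    exact zero_ne_one this
  have hAinv : A⁻¹ = Dᴴ := Matrix.inv_eq_left_inv hDA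
  refine ⟨A, Dᴴ * B, hA, ?_, ?_⟩
  · rw [isHermitian_iff_forall_im]
    intro x
    rw [← star_mulVec_dotProduct_mulVec, hBD]
  · ext z
    obtain ⟨x, y⟩ := z
    rw [LinearEquiv.trans_apply, ← hT, hTz, blockEquiv_apply, hAinv,
      Matrix.conjTranspose_conjTranspose, Matrix.mulVec_add, Matrix.mulVec_mulVec, ← mul_assoc,
      mul_eq_one_comm.1 hDA, one_mul]

/-- Any two adapted coordinate systems are joined by a path of adapted coordinate systems. -/
theorem exists_path_isAdapted (hΦ : IsAdapted P₀ Φ) (hΦ' : IsAdapted P₀ Φ') :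
    ∃ Ψ : unitInterval → ((Fin n → ℂ) × (Fin n → ℂ)) ≃ₗ[ℂ] S,
      (∀ s, IsAdapted P₀ (Ψ s)) ∧ Ψ 0 = Φ ∧ Ψ 1 = Φ' ∧
      Continuous fun q : unitInterval × ((Fin n → ℂ) × (Fin n → ℂ)) => Ψ q.1 q.2 := by
  obtain ⟨A, C, hA, hC, rfl⟩ := exists_blockEquiv hΦ hΦ'
  obtain ⟨γ, hγc, hγ0, hγ1, hγ⟩ := exists_path_det_ne_zero A hA
  -- The invertible block moves along a path from `1` to `A`, the Hermitian block along the segment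
  -- from `0` to `C`.
  refine ⟨fun s => (blockEquiv (γ s) ((s : ℝ) • C) (hγ s)).trans Φ, fun s => ?_, ?_, ?_, ?_⟩
  · exact hΦ.blockEquiv _ _ _ (hC.smul (IsSelfAdjoint.all _))
  · ext z
    simp [blockEquiv_apply, hγ0]
  · ext z
    simp [blockEquiv_apply, hγ1]
  · have hinv : Continuous fun s => (γ s)⁻¹ := by
      simp_rw [Matrix.inv_def, Ring.inverse_eq_inv']
      exact (hγc.matrix_det.inv₀ hγ).smul hγc.matrix_adjugate
    have hΦc : Continuous Φ := LinearMap.continuous_of_finiteDimensional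
      (Φ : ((Fin n → ℂ) × (Fin n → ℂ)) →ₗ[ℂ] S)
    refine hΦc.comp (f := fun q : unitInterval × ((Fin n → ℂ) × (Fin n → ℂ)) =>
      blockEquiv (γ q.1) ((q.1 : ℝ) • C) (hγ q.1) q.2) ?_
    refine Continuous.prodMk (Continuous.matrix_mulVec (hγc.comp continuous_fst)
      (Continuous.add (by fun_prop) (Continuous.matrix_mulVec (by fun_prop) (by fun_prop))))
      (Continuous.matrix_mulVec (hinv.comp continuous_fst).matrix_conjTranspose (by fun_prop))

end AdaptedPath

/-! ### Continuous arguments and integrality -/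

section Lifting

/-- A nowhere vanishing continuous function on a simply connected space has a continuous
argument. -/
theorem exists_continuous_arg {X : Type*} [TopologicalSpace X] [SimplyConnectedSpace X]
    [LocallyPathConnectedSpace X] (f : X → ℂ) (hf : Continuous f) (hf0 : ∀ x, f x ≠ 0) :
    ∃ θ : X → ℝ, Continuous θ ∧ ∀ x, f x = ‖f x‖ * Complex.exp (Complex.I * θ x) := by
  have hn : ∀ x, (‖f x‖ : ℂ) ≠ 0 := fun x => by exact_mod_cast norm_ne_zero_iff.2 (hf0 x)
  have hmem : ∀ x, f x / ‖f x‖ ∈ Submonoid.unitSphere ℂ := fun x => by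
    change _ ∈ Metric.sphere (0 : ℂ) 1
    rw [mem_sphere_zero_iff_norm, norm_div, Complex.norm_real, norm_norm, div_self]
    exact norm_ne_zero_iff.2 (hf0 x)
  let g : C(X, Circle) :=
    ⟨fun x => ⟨f x / ‖f x‖, hmem x⟩, (hf.div (Complex.continuous_ofReal.comp hf.norm) hn).subtype_mk hmem⟩
  obtain ⟨x₀⟩ : Nonempty X := inferInstance
  obtain ⟨F, ⟨-, hF⟩, -⟩ := Circle.isCoveringMap_exp.existsUnique_continuousMap_lifts g x₀
    (Complex.arg (g x₀)) (Circle.exp_arg _)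
  refine ⟨F, F.continuous, fun x => ?_⟩
  have h1 : (Circle.exp (F x) : ℂ) = f x / ‖f x‖ := congrArg Subtype.val (congrFun hF x)
  rw [Circle.coe_exp] at h1
  rw [mul_comm Complex.I, h1, mul_div_cancel₀ _ (hn x)]

theorem exists_int_of_exp_eq {z : ℂ} (hz : z ≠ 0) {x y : ℝ}
    (hx : z = ‖z‖ * Complex.exp (Complex.I * x)) (hy : z = ‖z‖ * Complex.exp (Complex.I * y)) :
    ∃ m : ℤ, x - y = 2 * Real.pi * m := by
  have hn : (‖z‖ : ℂ) ≠ 0 := by exact_mod_cast norm_ne_zero_iff.2 hz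
  have h1 := mul_left_cancel₀ hn (hx.symm.trans hy)
  obtain ⟨m, hm⟩ := Complex.exp_eq_exp_iff_exists_int.1 h1
  refine ⟨m, ?_⟩
  have h2 : Complex.I * ((x : ℂ) - (y + 2 * Real.pi * m)) = 0 := by linear_combination hm
  have h3 := (mul_eq_zero.1 h2).resolve_left Complex.I_ne_zero
  have h4 : x - (y + 2 * Real.pi * m) = 0 := by exact_mod_cast h3
  linarith

/-- The integer multiples of `c` form a discrete set, so a continuous function into it is constant
on a preconnected set. -/
theorem eq_of_integral_of_isPreconnected {X : Type*} [TopologicalSpace X] {s : Set X}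
    (hs : IsPreconnected s) {c : ℝ} (hc : c ≠ 0) {g : X → ℝ} (hg : ContinuousOn g s)
    (hint : ∀ x ∈ s, ∃ m : ℤ, g x = c * m) {x y : X} (hx : x ∈ s) (hy : y ∈ s) : g x = g y := by
  have hd : IsDiscrete (Set.range ((↑) : ℤ → ℝ)) :=
    ⟨Int.isClosedEmbedding_coe_real.isEmbedding.toHomeomorph.symm.isEmbedding.discreteTopology⟩
  have h1 := hs.constant_of_mapsTo hd (f := fun x => g x / c) (hg.div_const c)
    (fun x hx => by
      obtain ⟨m, hm⟩ := hint x hx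
      exact ⟨m, by simp only [hm]; field_simp⟩) hx hy
  field_simp at h1
  exact h1

end Lifting

/-! ### Construction of the index and verification of the axioms -/

section Index

variable {S : Type*} [NormedAddCommGroup S] [InnerProductSpace ℂ S] [FiniteDimensional ℂ S]
  {h : S →ₗ⋆[ℂ] S →ₗ[ℂ] ℂ} {n : ℕ} {P₀ : UManifold h}
  {Φ : ((Fin n → ℂ) × (Fin n → ℂ)) ≃ₗ[ℂ] S}

open Classical in
/-- An argument of `unitaryDet Φ` that is continuous off the singular variety. -/
def cellArg (Φ : ((Fin n → ℂ) × (Fin n → ℂ)) ≃ₗ[ℂ] S) (P : UManifold h) : ℝ :=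
  -- On singular subspaces any argument of `det U` will do. Having some argument everywhere keeps
  -- the index an integer for paths that are not admissible.
  if P ∈ chart h (swapCoord Φ) then n * Real.pi + 2 * arctanTrace (slope (swapCoord Φ) P)
  else Complex.arg (unitaryDet Φ P)

theorem cellArg_of_mem {P : UManifold h} (hP : P ∈ chart h (swapCoord Φ)) :
    cellArg Φ P = n * Real.pi + 2 * arctanTrace (slope (swapCoord Φ) P) := if_pos hP

theorem norm_mul_exp_of_eq_exp {z : ℂ} {x : ℝ} (hz : z = Complex.exp (Complex.I * x)) :
    z = ‖z‖ * Complex.exp (Complex.I * x) := by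
  have : ‖z‖ = 1 := by rw [hz, mul_comm, Complex.norm_exp_ofReal_mul_I]
  rw [this, Complex.ofReal_one, one_mul]
  exact hz

namespace IsAdapted

variable (hΦ : IsAdapted P₀ Φ)
include hΦ

theorem unitaryDet_eq_cellArg (P : UManifold h) :
    unitaryDet Φ P = ‖unitaryDet Φ P‖ * Complex.exp (Complex.I * cellArg Φ P) := by
  by_cases hP : P ∈ chart h (swapCoord Φ)
  · rw [cellArg_of_mem hP]
    apply norm_mul_exp_of_eq_exp
    have h1 := hΦ.isHermitian_slope_swap hP
    have h2 := hΦ.unitaryDet_mul_of_graphSpace_swap (graphSpace_slope hP)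
    rw [det_sub_I_smul_one h1] at h2
    exact mul_right_cancel₀ (det_add_I_smul_one_ne_zero h1) h2
  · rw [cellArg, if_neg hP, mul_comm Complex.I, Complex.norm_mul_exp_arg_mul_I]

theorem unitaryDet_eq_of_graphSpace {P : UManifold h} {X : Matrix (Fin n) (Fin n) ℂ}
    (hP : P.space = graphSpace Φ X) :
    unitaryDet Φ P =
      ‖unitaryDet Φ P‖ * Complex.exp (Complex.I * (-2 * arctanTrace X : ℝ)) := by
  have hX : X.IsHermitian := hΦ.isSuperlagrangian_graphSpace_iff.1 (hP ▸ P.2)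
  apply norm_mul_exp_of_eq_exp
  have h2 := hΦ.unitaryDet_mul_of_graphSpace hP
  rw [det_one_sub_I_smul hX] at h2
  exact mul_right_cancel₀ (det_one_add_I_smul_ne_zero hX) h2

theorem continuousOn_cellArg :
    ContinuousOn (cellArg Φ : UManifold h → ℝ) {P | P ∉ singularSet P₀} := by
  have h0 : {P : UManifold h | P ∉ singularSet P₀} = chart h (swapCoord Φ) :=
    Set.ext fun P => hΦ.notMem_singularSet_iff
  rw [h0, continuousOn_iff_continuous_domRestrict]
  have h1 : Continuous fun P : chart h (swapCoord Φ) =>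
      (⟨slope (swapCoord Φ) P.1, hΦ.isHermitian_slope_swap P.2⟩ :
        selfAdjoint (Matrix (Fin n) (Fin n) ℂ)) :=
    (continuousOn_iff_continuous_domRestrict.1 (continuousOn_slope _)).subtype_mk _
  have h2 : (chart h (swapCoord Φ)).domRestrict (cellArg Φ) = fun P =>
      n * Real.pi + 2 * arctanTrace (slope (swapCoord Φ) P.1) :=
    funext fun P => cellArg_of_mem P.2
  rw [h2]
  exact continuous_const.add (continuous_const.mul (continuous_arctanTrace.comp h1))

/-- The graph of an invertible `X` is the graph of `X⁻¹` over the other factor, and the arctangents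
of `X⁻¹` are traded for those of `X` at the cost of the signature. -/
theorem cellArg_of_graphSpace {P : UManifold h} {X : Matrix (Fin n) (Fin n) ℂ}
    (hP : P.space = graphSpace Φ X) (hX : X.IsHermitian) (hdet : X.det ≠ 0) :
    cellArg Φ P = n * Real.pi + Real.pi * matrixSign hX - 2 * arctanTrace X := by
  have h1 := hΦ.space_eq_graphSpace_swapCoord_inv hP hdet
  rw [cellArg_of_mem ⟨_, h1⟩, slope_eq h1]
  linarith [arctanTrace_add_arctanTrace_inv hX hdet]

end IsAdapted

/-- The extension of a path to the real line by its values at the endpoints. -/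
def UPath.extend (p : UPath h) (t : ℝ) : UManifold h := p.toMap (Set.projIcc p.a p.b p.lt.le t)

theorem UPath.continuous_extend (p : UPath h) : Continuous p.extend :=
  p.toMap.continuous.comp continuous_projIcc

theorem UPath.extend_of_mem (p : UPath h) {t : ℝ} (ht : t ∈ Set.Icc p.a p.b) :
    p.extend t = p.toMap ⟨t, ht⟩ := by
  unfold UPath.extend
  rw [Set.projIcc_of_mem _ ht]

theorem UPath.extend_restrict (p : UPath h) {c d : ℝ} (hcd : c < d) (hac : p.a ≤ c)
    (hdb : d ≤ p.b) {t : ℝ} (ht : t ∈ Set.Icc c d) :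
    (p.restrict c d hcd hac hdb).extend t = p.extend t := by
  rw [UPath.extend_of_mem _ (show t ∈ Set.Icc _ _ from ht),
    UPath.extend_of_mem _ (Set.Icc_subset_Icc hac hdb ht)]
  rfl

/-- A continuous argument of `unitaryDet Φ` along a path. -/
def IsArgAlong (Φ : ((Fin n → ℂ) × (Fin n → ℂ)) ≃ₗ[ℂ] S) (p : UPath h) (θ : ℝ → ℝ) : Prop :=
  ContinuousOn θ (Set.Icc p.a p.b) ∧ ∀ t ∈ Set.Icc p.a p.b,
    unitaryDet Φ (p.extend t) =
      ‖unitaryDet Φ (p.extend t)‖ * Complex.exp (Complex.I * θ t)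

/-- The variation of `cellArg Φ` along a path minus that of the continuous argument `θ`. -/
def argDefect (Φ : ((Fin n → ℂ) × (Fin n → ℂ)) ≃ₗ[ℂ] S) (p : UPath h) (θ : ℝ → ℝ) : ℝ :=
  cellArg Φ (p.extend p.b) - cellArg Φ (p.extend p.a) - (θ p.b - θ p.a)

theorem exists_isArgAlong (hΦ : IsAdapted P₀ Φ) (p : UPath h) : ∃ θ, IsArgAlong Φ p θ := by
  obtain ⟨θ, hθ, hθ'⟩ := exists_continuous_arg (fun t => unitaryDet Φ (p.extend t))
    (hΦ.continuous_unitaryDet.comp p.continuous_extend) fun t => hΦ.unitaryDet_ne_zero _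
  exact ⟨θ, hθ.continuousOn, fun t _ => hθ' t⟩

/-- At each end `cellArg` and `θ` are arguments of the same nonzero number, whether or not the end
is singular. -/
theorem exists_argDefect_eq (hΦ : IsAdapted P₀ Φ) {p : UPath h} {θ : ℝ → ℝ}
    (hθ : IsArgAlong Φ p θ) : ∃ m : ℤ, argDefect Φ p θ = 2 * Real.pi * m := by
  have ha : p.a ∈ Set.Icc p.a p.b := Set.left_mem_Icc.2 p.lt.le
  have hb : p.b ∈ Set.Icc p.a p.b := Set.right_mem_Icc.2 p.lt.le
  obtain ⟨k, hk⟩ := exists_int_of_exp_eq (hΦ.unitaryDet_ne_zero _)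
    (hΦ.unitaryDet_eq_cellArg (p.extend p.b)) (hθ.2 _ hb)
  obtain ⟨l, hl⟩ := exists_int_of_exp_eq (hΦ.unitaryDet_ne_zero _)
    (hΦ.unitaryDet_eq_cellArg (p.extend p.a)) (hθ.2 _ ha)
  refine ⟨k - l, ?_⟩
  unfold argDefect
  push_cast
  linarith

theorem argDefect_congr (hΦ : IsAdapted P₀ Φ) {p : UPath h} {θ θ' : ℝ → ℝ}
    (hθ : IsArgAlong Φ p θ) (hθ' : IsArgAlong Φ p θ') :
    argDefect Φ p θ = argDefect Φ p θ' := by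
  have ha : p.a ∈ Set.Icc p.a p.b := Set.left_mem_Icc.2 p.lt.le
  have hb : p.b ∈ Set.Icc p.a p.b := Set.right_mem_Icc.2 p.lt.le
  have h1 := eq_of_integral_of_isPreconnected isPreconnected_Icc
    (mul_ne_zero two_ne_zero Real.pi_ne_zero) (hθ.1.sub hθ'.1)
    (fun t ht => exists_int_of_exp_eq (hΦ.unitaryDet_ne_zero _) (hθ.2 t ht) (hθ'.2 t ht)) ha hb
  unfold argDefect
  simp only [Pi.sub_apply] at h1
  linarith

/-- The EM-index computed in adapted coordinates: the winding of `unitaryDet Φ` along a path,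
closed up outside the singular variety. -/
def emIndex (hΦ : IsAdapted P₀ Φ) (p : UPath h) : ℤ :=
  (exists_argDefect_eq hΦ (exists_isArgAlong hΦ p).choose_spec).choose

theorem argDefect_eq_emIndex (hΦ : IsAdapted P₀ Φ) {p : UPath h} {θ : ℝ → ℝ}
    (hθ : IsArgAlong Φ p θ) : argDefect Φ p θ = 2 * Real.pi * emIndex hΦ p := by
  rw [argDefect_congr hΦ hθ (exists_isArgAlong hΦ p).choose_spec]
  exact (exists_argDefect_eq hΦ (exists_isArgAlong hΦ p).choose_spec).choose_spec

theorem emIndex_eq_of_argDefect_eq (hΦ : IsAdapted P₀ Φ) {p q : UPath h} {θ η : ℝ → ℝ}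
    (hθ : IsArgAlong Φ p θ) (hη : IsArgAlong Φ q η) (hpq : argDefect Φ p θ = argDefect Φ q η) :
    emIndex hΦ p = emIndex hΦ q := by
  rw [argDefect_eq_emIndex hΦ hθ, argDefect_eq_emIndex hΦ hη] at hpq
  exact_mod_cast mul_left_cancel₀ (mul_ne_zero two_ne_zero Real.pi_ne_zero) hpq

/-- One continuous argument `θ` on the whole parameter plane serves every stage of the homotopy. The
defect is continuous in `s`, because the ends stay where `cellArg` is continuous, and its values lie
in `2π ℤ`. -/
theorem emIndex_homotopy (hΦ : IsAdapted P₀ Φ) {a b : ℝ} (hab : a < b)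
    (F : C(unitInterval × Set.Icc a b, UManifold h))
    (hFa : ∀ s, F (s, ⟨a, Set.left_mem_Icc.2 hab.le⟩) ∉ singularSet P₀)
    (hFb : ∀ s, F (s, ⟨b, Set.right_mem_Icc.2 hab.le⟩) ∉ singularSet P₀) (s₀ s₁ : unitInterval) :
    emIndex hΦ ⟨a, b, hab, F.comp ((ContinuousMap.const _ s₀).prodMk (ContinuousMap.id _))⟩ =
      emIndex hΦ ⟨a, b, hab, F.comp ((ContinuousMap.const _ s₁).prodMk (ContinuousMap.id _))⟩ := by
  let G : ℝ × ℝ → UManifold h := fun q =>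
    F (Set.projIcc 0 1 zero_le_one q.1, Set.projIcc a b hab.le q.2)
  have hG : Continuous G := F.continuous.comp
    ((continuous_projIcc.comp continuous_fst).prodMk (continuous_projIcc.comp continuous_snd))
  obtain ⟨θ, hθ, hθ'⟩ := exists_continuous_arg (fun q => unitaryDet Φ (G q))
    (hΦ.continuous_unitaryDet.comp hG) fun t => hΦ.unitaryDet_ne_zero _
  let p : unitInterval → UPath h := fun s =>
    ⟨a, b, hab, F.comp ((ContinuousMap.const _ s).prodMk (ContinuousMap.id _))⟩
  have hp : ∀ s t, (p s).extend t = G (s, t) := by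
    intro s t
    change F _ = F _
    congr 1
    ext1
    · exact (Set.projIcc_val zero_le_one s).symm
    · rfl
  have hlift : ∀ s : unitInterval, IsArgAlong Φ (p s) fun t => θ (s, t) := by
    intro s
    refine ⟨(hθ.comp (Continuous.prodMk continuous_const continuous_id)).continuousOn,
      fun t _ => ?_⟩
    rw [hp]
    exact hθ' _
  refine emIndex_eq_of_argDefect_eq hΦ (hlift s₀) (hlift s₁) ?_
  have hend : ∀ t : Set.Icc a b, (∀ s, F (s, t) ∉ singularSet P₀) →
      Continuous fun s : unitInterval => cellArg Φ ((p s).extend t) := by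
    intro t ht
    have h1 : ∀ s, (p s).extend t = F (s, t) := fun s => UPath.extend_of_mem (p s) t.2
    simp_rw [h1]
    exact hΦ.continuousOn_cellArg.comp_continuous
      (F.continuous.comp (continuous_id.prodMk continuous_const)) ht
  have hθs : ∀ t : ℝ, Continuous fun s : unitInterval => θ (s, t) := fun t =>
    hθ.comp (continuous_subtype_val.prodMk continuous_const)
  have hcont : Continuous fun s : unitInterval => argDefect Φ (p s) fun t => θ (s, t) :=
    ((hend _ hFb).sub (hend _ hFa)).sub ((hθs b).sub (hθs a))
  exact eq_of_integral_of_isPreconnected isPreconnected_univ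
    (mul_ne_zero two_ne_zero Real.pi_ne_zero) hcont.continuousOn
    (fun s _ => exists_argDefect_eq hΦ (hlift s)) (Set.mem_univ s₀) (Set.mem_univ s₁)

theorem emIndex_eq_of_homotopy (hΦ : IsAdapted P₀ Φ) {a b : ℝ} (hab : a < b)
    {p q : C(Set.Icc a b, UManifold h)}
    (hpq : ContinuousMap.HomotopicWith p q
      (fun r => (⟨a, b, hab, r⟩ : UPath h) ∈ UPath.admissible P₀)) :
    emIndex hΦ ⟨a, b, hab, p⟩ = emIndex hΦ ⟨a, b, hab, q⟩ := by
  obtain ⟨F⟩ := hpq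
  have h1 := emIndex_homotopy hΦ hab F.toContinuousMap (fun s => (F.prop' s).1)
    (fun s => (F.prop' s).2) 0 1
  convert! h1 using 3
  · ext1 t
    exact (F.map_zero_left t).symm
  · ext1 t
    exact (F.map_one_left t).symm

/-- One argument `θ` serves the path and both pieces, and the values of `cellArg` and `θ` at `c`
cancel, wherever `p c` lies. -/
theorem emIndex_catenation (hΦ : IsAdapted P₀ Φ) (p : UPath h) {c : ℝ} (hac : p.a < c)
    (hcb : c < p.b) :
    emIndex hΦ p = emIndex hΦ (p.restrict p.a c hac le_rfl hcb.le) +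
      emIndex hΦ (p.restrict c p.b hcb hac.le le_rfl) := by
  obtain ⟨θ, hθ⟩ := exists_isArgAlong hΦ p
  have hr : ∀ {c d : ℝ} (hcd : c < d) (hac : p.a ≤ c) (hdb : d ≤ p.b),
      IsArgAlong Φ (p.restrict c d hcd hac hdb) θ := by
    intro c d hcd hac hdb
    refine ⟨hθ.1.mono (Set.Icc_subset_Icc hac hdb), fun t ht => ?_⟩
    rw [UPath.extend_restrict p hcd hac hdb ht]
    exact hθ.2 t (Set.Icc_subset_Icc hac hdb ht)
  have h0 := argDefect_eq_emIndex hΦ hθ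
  have h1 := argDefect_eq_emIndex hΦ (hr hac le_rfl hcb.le)
  have h2 := argDefect_eq_emIndex hΦ (hr hcb hac.le le_rfl)
  have hd : ∀ {c d : ℝ} (hcd : c < d) (hac : p.a ≤ c) (hdb : d ≤ p.b),
      argDefect Φ (p.restrict c d hcd hac hdb) θ =
        cellArg Φ (p.extend d) - cellArg Φ (p.extend c) - (θ d - θ c) := by
    intro c d hcd hac hdb
    rw [← UPath.extend_restrict p hcd hac hdb (Set.left_mem_Icc.2 hcd.le),
      ← UPath.extend_restrict p hcd hac hdb (Set.right_mem_Icc.2 hcd.le)]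
    rfl
  rw [hd] at h1 h2
  have h3 : (2 * Real.pi) * (emIndex hΦ p : ℝ) = 2 * Real.pi *
      (emIndex hΦ (p.restrict p.a c hac le_rfl hcb.le) +
        emIndex hΦ (p.restrict c p.b hcb hac.le le_rfl)) := by
    rw [← h0, mul_add, ← h1, ← h2]
    unfold argDefect
    ring
  exact_mod_cast mul_left_cancel₀ (mul_ne_zero two_ne_zero Real.pi_ne_zero) h3

/-- The index of an admissible path of graphs in the chart in which the index is computed. -/
theorem two_mul_emIndex_of_graphSpace (hΦ : IsAdapted P₀ Φ) (p : UPath h)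
    {H : ℝ → Matrix (Fin n) (Fin n) ℂ} (hH : ∀ t ∈ Set.Icc p.a p.b, (H t).IsHermitian)
    (hc : ContinuousOn H (Set.Icc p.a p.b))
    (hp : ∀ t ∈ Set.Icc p.a p.b, (p.extend t).space = graphSpace Φ (H t))
    (ha : (H p.a).det ≠ 0) (hb : (H p.b).det ≠ 0) :
    2 * emIndex hΦ p = matrixSign (hH p.b (Set.right_mem_Icc.2 p.lt.le)) -
      matrixSign (hH p.a (Set.left_mem_Icc.2 p.lt.le)) := by
  have hma := Set.left_mem_Icc.2 p.lt.le
  have hmb := Set.right_mem_Icc.2 p.lt.le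
  -- With this argument the arctangent terms of `cellArg` at the ends cancel and only `π` times the
  -- jump of the signature remains.
  have hθ : IsArgAlong Φ p fun t => -2 * arctanTrace (H t) := by
    refine ⟨?_, fun t ht => hΦ.unitaryDet_eq_of_graphSpace (hp t ht)⟩
    rw [continuousOn_iff_continuous_domRestrict]
    have h1 : Continuous fun t : Set.Icc p.a p.b =>
        (⟨H t, hH t t.2⟩ : selfAdjoint (Matrix (Fin n) (Fin n) ℂ)) :=
      (continuousOn_iff_continuous_domRestrict.1 hc).subtype_mk _
    exact continuous_const.mul (continuous_arctanTrace.comp h1)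
  have h1 := argDefect_eq_emIndex hΦ hθ
  unfold argDefect at h1
  rw [hΦ.cellArg_of_graphSpace (hp _ hma) (hH _ hma) ha,
    hΦ.cellArg_of_graphSpace (hp _ hmb) (hH _ hmb) hb] at h1
  have h2 : Real.pi * (2 * emIndex hΦ p : ℝ) =
      Real.pi * (matrixSign (hH p.b hmb) - matrixSign (hH p.a hma)) := by
    linarith
  exact_mod_cast mul_left_cancel₀ Real.pi_ne_zero h2

/-- The signature is constant along a path of invertible Hermitian matrices. -/
theorem matrixSign_eq_of_det_ne_zero {H : ℝ → Matrix (Fin n) (Fin n) ℂ} {c d : ℝ} (hcd : c ≤ d)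
    (hH : ∀ t ∈ Set.Icc c d, (H t).IsHermitian) (hc : ContinuousOn H (Set.Icc c d))
    (hdet : ∀ t ∈ Set.Icc c d, (H t).det ≠ 0) :
    matrixSign (hH c (Set.left_mem_Icc.2 hcd)) = matrixSign (hH d (Set.right_mem_Icc.2 hcd)) := by
  have hr := continuousOn_iff_continuous_domRestrict.1 hc
  have h1 : Continuous fun t : Set.Icc c d => arctanTrace (H t) :=
    continuous_arctanTrace.comp (hr.subtype_mk fun t => hH t t.2)
  have hinv : Continuous fun t : Set.Icc c d => (H t)⁻¹ := by
    simp_rw [Matrix.inv_def, Ring.inverse_eq_inv']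
    exact (hr.matrix_det.inv₀ fun t => hdet t t.2).smul hr.matrix_adjugate
  have h2 : Continuous fun t : Set.Icc c d => arctanTrace (H t)⁻¹ :=
    continuous_arctanTrace.comp (hinv.subtype_mk fun t => (hH t t.2).inv)
  have hpre : IsPreconnected (Set.univ : Set (Set.Icc c d)) :=
    Subtype.preconnectedSpace isPreconnected_Icc |>.isPreconnected_univ
  -- `arctanTrace H + arctanTrace H⁻¹` is continuous and equals `π / 2` times the integer signature.
  have h3 := eq_of_integral_of_isPreconnected hpre (c := Real.pi / 2) (by positivity)
    (h1.add h2).continuousOn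
    (fun t _ => ⟨_, arctanTrace_add_arctanTrace_inv (hH t t.2) (hdet t t.2)⟩)
    (Set.mem_univ ⟨c, Set.left_mem_Icc.2 hcd⟩) (Set.mem_univ ⟨d, Set.right_mem_Icc.2 hcd⟩)
  rw [Pi.add_apply, Pi.add_apply, arctanTrace_add_arctanTrace_inv (hH _ (Set.left_mem_Icc.2 hcd)) (hdet _ (Set.left_mem_Icc.2 hcd)),
    arctanTrace_add_arctanTrace_inv (hH _ (Set.right_mem_Icc.2 hcd)) (hdet _ (Set.right_mem_Icc.2 hcd))] at h3
  exact_mod_cast mul_left_cancel₀ (by positivity) h3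

/-- The index of an admissible path of graphs in any adapted chart. -/
theorem two_mul_emIndex_of_isAdapted (hΦ : IsAdapted P₀ Φ)
    {Φ' : ((Fin n → ℂ) × (Fin n → ℂ)) ≃ₗ[ℂ] S} (hΦ' : IsAdapted P₀ Φ') (p : UPath h)
    {H : ℝ → Matrix (Fin n) (Fin n) ℂ} (hH : ∀ t ∈ Set.Icc p.a p.b, (H t).IsHermitian)
    (hc : ContinuousOn H (Set.Icc p.a p.b))
    (hp : ∀ t ∈ Set.Icc p.a p.b, (p.extend t).space = graphSpace Φ' (H t))
    (ha : (H p.a).det ≠ 0) (hb : (H p.b).det ≠ 0) :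
    2 * emIndex hΦ p = matrixSign (hH p.b (Set.right_mem_Icc.2 p.lt.le)) -
      matrixSign (hH p.a (Set.left_mem_Icc.2 p.lt.le)) := by
  obtain ⟨Ψ, hΨ, hΨ0, hΨ1, hΨc⟩ := exists_path_isAdapted hΦ hΦ'
  have hr := continuousOn_iff_continuous_domRestrict.1 hc
  -- The homotopy keeps the matrices `H t` and moves the coordinates. Its ends stay nonsingular,
  -- since in every adapted system this only asks for `H` to be invertible there.
  let f : unitInterval × Set.Icc p.a p.b → UManifold h := fun q =>
    hermitianGraph (hΨ q.1) ⟨H q.2, hH q.2 q.2.2⟩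
  have hf : Continuous f := by
    refine UManifold.continuous_of_frame (fun q => graphFrame (Ψ q.1) (H q.2)) (fun v => ?_)
      (fun q => graphFrame_injective _ _) (fun q => (range_graphFrame _ _).symm)
    exact hΨc.comp (f := fun q : unitInterval × Set.Icc p.a p.b => (q.1, (v, H q.2 *ᵥ v)))
      (continuous_fst.prodMk (continuous_const.prodMk
        ((hr.comp continuous_snd).matrix_mulVec continuous_const)))
  have key := emIndex_homotopy hΦ p.lt ⟨f, hf⟩
    (fun s => ((hΨ s).notMem_singularSet_iff_of_graphSpace rfl).2 ha)
    (fun s => ((hΨ s).notMem_singularSet_iff_of_graphSpace rfl).2 hb) 1 0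
  have h1 : (⟨p.a, p.b, p.lt, (⟨f, hf⟩ : C(unitInterval × Set.Icc p.a p.b, UManifold h)).comp
      ((ContinuousMap.const _ 1).prodMk (ContinuousMap.id _))⟩ : UPath h) = p := by
    obtain ⟨a, b, hab, m⟩ := p
    congr 1
    ext1 t
    apply UManifold.ext
    have h2 := hp t t.2
    rw [UPath.extend_of_mem _ (show (t : ℝ) ∈ Set.Icc _ _ from t.2)] at h2
    refine Eq.trans ?_ h2.symm
    change graphSpace (Ψ 1) (H t) = _
    rw [hΨ1]
  rw [h1] at key
  rw [key]
  set q : UPath h := ⟨p.a, p.b, p.lt, (⟨f, hf⟩ : C(unitInterval × Set.Icc p.a p.b, UManifold h)).comp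
    ((ContinuousMap.const _ 0).prodMk (ContinuousMap.id _))⟩
  refine two_mul_emIndex_of_graphSpace hΦ q hH hc (fun t ht => ?_) ha hb
  rw [UPath.extend_of_mem _ ht]
  change graphSpace (Ψ 0) (H t) = _
  rw [hΨ0]

/-- The index computed in adapted coordinates satisfies the axioms on any class of paths. -/
theorem isEMIndex_emIndex (hΦ : IsAdapted P₀ Φ) (D : Set (UPath h)) :
    IsEMIndex P₀ D fun p => emIndex hΦ p.1 where
  homotopy _ _ hab _ _ _ _ hpq := emIndex_eq_of_homotopy hΦ hab hpq
  catenation p _ hac hcb _ _ _ _ := emIndex_catenation hΦ p hac hcb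
  localization := by
    intro k Φ' hΦ' p _ hadm H hH hdiff hgraph t₀ ht₀ hsing _ ε hε h₁ h₂
    obtain rfl : k = n := by
      have h3 := finrank_of_coordinates Φ
      have h4 := finrank_of_coordinates Φ'
      omega
    have hma := Set.left_mem_Icc.2 p.lt.le
    have hmb := Set.right_mem_Icc.2 p.lt.le
    have hdet : ∀ t ∈ Set.Icc p.a p.b, t ≠ t₀ → (H t).det ≠ 0 := by
      intro t ht hne
      rw [← hΦ'.notMem_singularSet_iff_of_graphSpace (hgraph t ht), hsing t ht]
      exact hne
    have hc := hdiff.continuousOn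
    have h3 := two_mul_emIndex_of_isAdapted hΦ hΦ' p hH hc
      (fun t ht => by rw [UPath.extend_of_mem _ ht]; exact hgraph t ht)
      (hdet _ hma (by linarith [h₁.1])) (hdet _ hmb (by linarith [h₂.2]))
    have hs₁ : Set.Icc p.a (t₀ - ε) ⊆ Set.Icc p.a p.b := Set.Icc_subset_Icc le_rfl h₁.2
    have hs₂ : Set.Icc (t₀ + ε) p.b ⊆ Set.Icc p.a p.b := Set.Icc_subset_Icc h₂.1 le_rfl
    -- `H` is invertible on either side of `t₀`, so the signatures at the ends of the interval equal
    -- those at `t₀ - ε` and `t₀ + ε`.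
    have h4 := matrixSign_eq_of_det_ne_zero h₁.1 (fun t ht => hH t (hs₁ ht)) (hc.mono hs₁)
      (fun t ht => hdet t (hs₁ ht) (by linarith [ht.2]))
    have h5 := matrixSign_eq_of_det_ne_zero h₂.2 (fun t ht => hH t (hs₂ ht)) (hc.mono hs₂)
      (fun t ht => hdet t (hs₂ ht) (by linarith [ht.1]))
    rw [h4, ← h5] at h3
    have h6 : (2 * emIndex hΦ p : ℚ) =
        matrixSign (hH (t₀ + ε) h₂) - matrixSign (hH (t₀ - ε) h₁) := by exact_mod_cast h3
    linarith

end Index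

/-! ### Hermitian involutions and pencils with one crossing -/

section Involutions

variable {n : ℕ} {A σ : Matrix (Fin n) (Fin n) ℂ}

/-- An invertible Hermitian matrix is joined to a Hermitian involution by a segment of invertible
matrices. -/
theorem exists_involution_segment (hA : A.IsHermitian) (hdet : A.det ≠ 0) :
    ∃ σ : Matrix (Fin n) (Fin n) ℂ, σ.IsHermitian ∧ σ * σ = 1 ∧
      ∀ s ∈ Set.Icc (0 : ℝ) 1, ((1 - s) • A + s • σ).det ≠ 0 := by
  let φ := Unitary.conjStarAlgAut ℝ (Matrix (Fin n) (Fin n) ℂ) hA.eigenvectorUnitary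
  let d : (Fin n → ℝ) → Matrix (Fin n) (Fin n) ℂ := fun v => Matrix.diagonal fun i => (v i : ℂ)
  have hφdet : ∀ v, (φ (d v)).det = ∏ i, (v i : ℂ) := by
    intro v
    rw [Unitary.conjStarAlgAut_apply, Matrix.det_mul, Matrix.det_mul, mul_right_comm,
      ← Matrix.det_mul,
      show (hA.eigenvectorUnitary : Matrix (Fin n) (Fin n) ℂ) * star ↑hA.eigenvectorUnitary = 1 from
      Unitary.coe_mul_star_self _, Matrix.det_one, one_mul, Matrix.det_diagonal]
  have hAφ : A = φ (d hA.eigenvalues) := by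
    conv_lhs => rw [hA.spectral_theorem]
    rfl
  -- The involution replaces each eigenvalue by its sign, so every eigenvalue keeps its sign along
  -- the segment.
  let ε : Fin n → ℝ := fun i => if 0 < hA.eigenvalues i then 1 else -1
  have hε : ∀ i, ε i * ε i = 1 := fun i => by
    by_cases hi : 0 < hA.eigenvalues i <;> simp [ε, hi]
  refine ⟨φ (d ε), ?_, ?_, fun s hs => ?_⟩
  · change star _ = _
    rw [← map_star]
    congr 1
    rw [Matrix.star_eq_conjTranspose, Matrix.diagonal_conjTranspose]
    congr 1
    funext i
    simp
  · rw [← map_mul, Matrix.diagonal_mul_diagonal, ← map_one φ, ← Matrix.diagonal_one]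
    congr 2
    funext i
    exact_mod_cast hε i
  · have h1 : (1 - s) • A + s • φ (d ε) = φ (d fun i => (1 - s) * hA.eigenvalues i + s * ε i) := by
      conv_lhs => rw [hAφ]
      rw [← map_smul, ← map_smul, ← map_add, ← Matrix.diagonal_smul, ← Matrix.diagonal_smul,
        Matrix.diagonal_add]
      congr 2
      funext i
      simp
    rw [h1, hφdet, Finset.prod_ne_zero_iff]
    intro i _
    have h0 := eigenvalues_ne_zero hA hdet i
    simp only [ε]
    rw [← Complex.ofReal_zero, Ne, Complex.ofReal_inj, ← Ne]
    rcases lt_or_gt_of_ne h0 with hi | hi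
    · rw [if_neg hi.not_gt]
      rcases eq_or_lt_of_le hs.1 with h | h
      · subst h; linarith
      · nlinarith [hs.2]
    · rw [if_pos hi]
      rcases eq_or_lt_of_le hs.1 with h | h
      · subst h; linarith
      · nlinarith [hs.2]

/-- The pencil of matrices that is `1` on the `1`-eigenspace and `r` on the `-1`-eigenspace of an
involution `σ`. -/
def involutionPencil (σ : Matrix (Fin n) (Fin n) ℂ) (r : ℝ) : Matrix (Fin n) (Fin n) ℂ :=
  ((1 + r) / 2) • 1 + ((1 - r) / 2) • σ

theorem involutionPencil_one_right (σ : Matrix (Fin n) (Fin n) ℂ) : involutionPencil σ 1 = 1 := by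
  simp [involutionPencil]

theorem involutionPencil_neg_one (σ : Matrix (Fin n) (Fin n) ℂ) :
    involutionPencil σ (-1) = σ := by
  unfold involutionPencil
  norm_num

theorem involutionPencil_one_left (r : ℝ) :
    involutionPencil (1 : Matrix (Fin n) (Fin n) ℂ) r = 1 := by
  unfold involutionPencil
  rw [← add_smul, ← add_div, show 1 + r + (1 - r) = 2 by ring, div_self two_ne_zero, one_smul]

theorem continuous_involutionPencil (σ : Matrix (Fin n) (Fin n) ℂ) :
    Continuous (involutionPencil σ) := by
  unfold involutionPencil
  fun_prop

theorem isHermitian_involutionPencil (hσ : σ.IsHermitian) (r : ℝ) :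
    (involutionPencil σ r).IsHermitian :=
  (Matrix.isHermitian_one.smul (IsSelfAdjoint.all _)).add (hσ.smul (IsSelfAdjoint.all _))

theorem hasDerivAt_involutionPencil (σ : Matrix (Fin n) (Fin n) ℂ) (k t₀ t : ℝ) :
    HasDerivAt (fun t => involutionPencil σ (k * (t - t₀))) ((k / 2) • (1 - σ)) t := by
  let _ : NormedAddCommGroup (Matrix (Fin n) (Fin n) ℂ) := Matrix.normedAddCommGroup
  let _ : NormedSpace ℝ (Matrix (Fin n) (Fin n) ℂ) := Matrix.normedSpace
  have h1 : HasDerivAt (fun t => k * (t - t₀)) k t := by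
    simpa using ((hasDerivAt_id t).sub_const t₀).const_mul k
  have h2 := (((h1.const_add 1).div_const 2).smul_const (1 : Matrix (Fin n) (Fin n) ℂ)).add
    (((h1.const_sub 1).div_const 2).smul_const σ)
  convert! h2 using 1
  rw [smul_sub, neg_div, neg_smul, sub_eq_add_neg]

/-- Changing the sign of the `σ` term gives a matrix whose product with the pencil is `r`, because
`σ² = 1`. At `r = 0` the pencil annihilates `σ - 1`, which is nonzero. -/
theorem det_involutionPencil_eq_zero_iff (hσ : σ * σ = 1) (hne : σ ≠ 1) (r : ℝ) :
    (involutionPencil σ r).det = 0 ↔ r = 0 := by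
  constructor
  · intro h0
    by_contra hr
    have h1 : involutionPencil σ r * (((1 + r) / 2) • 1 - ((1 - r) / 2) • σ) = r • 1 := by
      unfold involutionPencil
      rw [add_mul, mul_sub, mul_sub]
      simp only [smul_mul_smul_comm, hσ, mul_one, one_mul]
      rw [mul_comm ((1 - r) / 2) ((1 + r) / 2), sub_add_sub_cancel, ← sub_smul]
      congr 1
      ring
    have h2 := congrArg Matrix.det h1
    rw [Matrix.det_mul, h0, zero_mul, Matrix.det_smul_of_tower, Matrix.det_one] at h2
    have h3 : (r ^ Fintype.card (Fin n)) • (1 : ℂ) ≠ 0 :=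
      smul_ne_zero (pow_ne_zero _ hr) one_ne_zero
    exact h3 h2.symm
  · rintro rfl
    by_contra h0
    apply hne
    have h1 : involutionPencil σ 0 * (σ - 1) = 0 := by
      unfold involutionPencil
      rw [add_mul, smul_mul_assoc, smul_mul_assoc, mul_sub, mul_sub, hσ]
      simp only [mul_one, one_mul, add_zero, sub_zero, ← smul_add]
      simp
    have h2 := congrArg ((involutionPencil σ 0)⁻¹ * ·) h1
    simp only [mul_zero, ← mul_assoc] at h2
    rw [Matrix.nonsing_inv_mul _ (isUnit_iff_ne_zero.2 h0), one_mul] at h2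
    exact sub_eq_zero.1 h2

-- The kernel at `t₀` is the `-1`-eigenspace of `σ`. There the derivative `(k / 2) (1 - σ)` is
-- multiplication by `k`, so the crossing form is definite.
open scoped ComplexOrder in
theorem isRegularCrossing_involutionPencil {k : ℝ} (hk : k ≠ 0) (t₀ : ℝ) :
    IsRegularCrossing (fun t => involutionPencil σ (k * (t - t₀))) t₀ := by
  intro u hu hw
  have h1 : σ *ᵥ u = -u := by
    simp only [sub_self, mul_zero] at hu
    unfold involutionPencil at hu
    rw [add_zero, sub_zero, ← smul_add, Matrix.smul_mulVec, smul_eq_zero, Matrix.add_mulVec,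
      Matrix.one_mulVec] at hu
    exact (neg_eq_of_add_eq_zero_right (hu.resolve_left (by norm_num))).symm
  have h2 := hw u hu
  have hd : deriv (fun t => involutionPencil σ (k * (t - t₀))) t₀ = (k / 2) • (1 - σ) := by
    let _ : NormedAddCommGroup (Matrix (Fin n) (Fin n) ℂ) := Matrix.normedAddCommGroup
    let _ : NormedSpace ℝ (Matrix (Fin n) (Fin n) ℂ) := Matrix.normedSpace
    exact (hasDerivAt_involutionPencil σ k t₀ t₀).deriv
  rw [hd, Matrix.smul_mulVec, Matrix.sub_mulVec,
    Matrix.one_mulVec, h1, sub_neg_eq_add, ← two_smul ℝ u, smul_smul, dotProduct_smul,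
    smul_eq_zero] at h2
  exact dotProduct_star_self_eq_zero.1 (h2.resolve_left (by simpa using hk))

end Involutions

/-! ### Uniqueness: the axioms determine the index -/

section Uniqueness

variable {S : Type*} [NormedAddCommGroup S] [InnerProductSpace ℂ S] [FiniteDimensional ℂ S]
  {h : S →ₗ⋆[ℂ] S →ₗ[ℂ] ℂ} {n : ℕ} {P₀ : UManifold h}
  {Φ : ((Fin n → ℂ) × (Fin n → ℂ)) ≃ₗ[ℂ] S}

/-- The restriction of a map of the real line to an interval. -/
def segment (f : C(ℝ, UManifold h)) (a b : ℝ) (hab : a < b) : UPath h :=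
  ⟨a, b, hab, f.comp ⟨Subtype.val, continuous_subtype_val⟩⟩

theorem segment_congr {f g : C(ℝ, UManifold h)} {a b : ℝ} (hab : a < b)
    (hfg : ∀ t ∈ Set.Icc a b, f t = g t) : segment f a b hab = segment g a b hab := by
  unfold segment
  congr 1
  ext1 t
  exact hfg t t.2

theorem segment_mem_admissible {f : C(ℝ, UManifold h)} {a b : ℝ} (hab : a < b) :
    segment f a b hab ∈ UPath.admissible P₀ ↔ f a ∉ singularSet P₀ ∧ f b ∉ singularSet P₀ :=
  Iff.rfl

theorem segment_extend (p : UPath h) :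
    segment ⟨p.extend, p.continuous_extend⟩ p.a p.b p.lt = p := by
  obtain ⟨a, b, hab, m⟩ := p
  unfold segment
  congr 1
  ext1 t
  exact UPath.extend_of_mem _ (show (t : ℝ) ∈ Set.Icc _ _ from t.2)

theorem continuous_rotate_exp (hΦ : IsAdapted P₀ Φ) {X : Type*} [TopologicalSpace X] {θ : X → ℝ}
    {P : X → UManifold h} (hθ : Continuous θ) (hP : Continuous P) :
    Continuous fun x => rotate hΦ (Circle.exp (θ x)) (P x) := by
  have h1 : Continuous fun x => Circle.exp (θ x) := Circle.exp.continuous.comp hθ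
  exact (continuous_rotate hΦ).comp (f := fun x => (Circle.exp (θ x), P x)) (h1.prodMk hP)

/-- Two maps on admissible paths agree on `p`, if `p` is admissible. -/
def AgreeOn (μ ν : UPath.admissible P₀ → ℤ) (p : UPath h) : Prop :=
  ∀ hp : p ∈ UPath.admissible P₀, μ ⟨p, hp⟩ = ν ⟨p, hp⟩

variable {μ ν : UPath.admissible P₀ → ℤ}
  (hμ : IsEMIndex P₀ (UPath.admissible P₀) μ) (hν : IsEMIndex P₀ (UPath.admissible P₀) ν)
include hμ hν

theorem agreeOn_of_homotopy {a b : ℝ} (hab : a < b) {f g : C(ℝ, UManifold h)}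
    (G : unitInterval × ℝ → UManifold h) (hG : Continuous G)
    (hG0 : ∀ t ∈ Set.Icc a b, G (0, t) = f t) (hG1 : ∀ t ∈ Set.Icc a b, G (1, t) = g t)
    (hGa : ∀ s, G (s, a) ∉ singularSet P₀) (hGb : ∀ s, G (s, b) ∉ singularSet P₀)
    (hg : AgreeOn μ ν (segment g a b hab)) : AgreeOn μ ν (segment f a b hab) := by
  intro hf
  have hma := Set.left_mem_Icc.2 hab.le
  have hmb := Set.right_mem_Icc.2 hab.le
  have hg' : segment g a b hab ∈ UPath.admissible P₀ := by
    rw [segment_mem_admissible, ← hG1 a hma, ← hG1 b hmb]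
    exact ⟨hGa 1, hGb 1⟩
  let c : C(Set.Icc a b, ℝ) := ⟨Subtype.val, continuous_subtype_val⟩
  have hom : ContinuousMap.HomotopicWith (f.comp c) (g.comp c)
      (fun r => (⟨a, b, hab, r⟩ : UPath h) ∈ UPath.admissible P₀) :=
    ⟨{  toFun := fun q => G (q.1, q.2)
        continuous_toFun := hG.comp
          (continuous_fst.prodMk (continuous_subtype_val.comp continuous_snd))
        map_zero_left := fun t => hG0 t t.2
        map_one_left := fun t => hG1 t t.2
        prop' := fun s => ⟨hGa s, hGb s⟩ }⟩
  exact (hμ.homotopy a b hab _ _ hf hg' hom).trans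
    ((hg hg').trans (hν.homotopy a b hab _ _ hf hg' hom).symm)

theorem agreeOn_catenation {f : C(ℝ, UManifold h)} {a c b : ℝ} (hac : a < c) (hcb : c < b)
    (hc : f c ∉ singularSet P₀) (h₁ : AgreeOn μ ν (segment f a c hac))
    (h₂ : AgreeOn μ ν (segment f c b hcb)) : AgreeOn μ ν (segment f a b (hac.trans hcb)) := by
  intro hp
  have hl : segment f a c hac ∈ UPath.admissible P₀ := ⟨hp.1, hc⟩
  have hr : segment f c b hcb ∈ UPath.admissible P₀ := ⟨hc, hp.2⟩
  have e₁ := hμ.catenation (segment f a b (hac.trans hcb)) c hac hcb hp hl hr hc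
  have e₂ := hν.catenation (segment f a b (hac.trans hcb)) c hac hcb hp hl hr hc
  rw [e₁, e₂]
  exact congrArg₂ (· + ·) (h₁ hl) (h₂ hr)

/-- Catenation read backwards: the index of the right piece is that of the whole minus that of the
left piece. -/
theorem agreeOn_right_of_catenation {f : C(ℝ, UManifold h)} {a c b : ℝ} (hac : a < c)
    (hcb : c < b) (ha : f a ∉ singularSet P₀) (h₁ : AgreeOn μ ν (segment f a c hac))
    (h₂ : AgreeOn μ ν (segment f a b (hac.trans hcb))) : AgreeOn μ ν (segment f c b hcb) := by
  intro hr
  have hl : segment f a c hac ∈ UPath.admissible P₀ := ⟨ha, hr.1⟩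
  have hp : segment f a b (hac.trans hcb) ∈ UPath.admissible P₀ := ⟨ha, hr.2⟩
  have e₁ := hμ.catenation (segment f a b (hac.trans hcb)) c hac hcb hp hl hr hr.1
  have e₂ := hν.catenation (segment f a b (hac.trans hcb)) c hac hcb hp hl hr hr.1
  rw [h₂ hp, e₂] at e₁
  have e₃ : μ ⟨segment f a c hac, hl⟩ = ν ⟨segment f a c hac, hl⟩ := h₁ hl
  change ν ⟨segment f a c hac, hl⟩ + ν ⟨segment f c b hcb, hr⟩ =
    μ ⟨segment f a c hac, hl⟩ + μ ⟨segment f c b hcb, hr⟩ at e₁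
  omega

theorem agreeOn_of_localization (hΦ : IsAdapted P₀ Φ) {f : C(ℝ, UManifold h)} {a b t₀ : ℝ}
    (hab : a < b) {H : ℝ → Matrix (Fin n) (Fin n) ℂ} (hH : ∀ t, (H t).IsHermitian)
    (hdiff : Differentiable ℝ H) (hf : ∀ t, (f t).space = graphSpace Φ (H t))
    (ht₀ : t₀ ∈ Set.Ioo a b) (hsing : ∀ t, (H t).det = 0 ↔ t = t₀)
    (hreg : IsRegularCrossing H t₀) : AgreeOn μ ν (segment f a b hab) := by
  intro hp
  have hs : ∀ t (ht : t ∈ Set.Icc a b), (segment f a b hab).at' t ht ∈ singularSet P₀ ↔ t = t₀ := by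
    intro t _
    rw [← hsing, ← not_iff_not, ← Ne, ← hΦ.notMem_singularSet_iff_of_graphSpace (hf t)]
    rfl
  let ε := min (t₀ - a) (b - t₀)
  have hε : 0 < ε := lt_min (sub_pos.2 ht₀.1) (sub_pos.2 ht₀.2)
  have hε₁ : ε ≤ t₀ - a := min_le_left _ _
  have hε₂ : ε ≤ b - t₀ := min_le_right _ _
  have h₁ : t₀ - ε ∈ Set.Icc a b := ⟨by linarith, by linarith [ht₀.2]⟩
  have h₂ : t₀ + ε ∈ Set.Icc a b := ⟨by linarith [ht₀.1], by linarith⟩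
  have e₁ := hμ.localization n Φ hΦ (segment f a b hab) hp hp H (fun t _ => hH t)
    hdiff.differentiableOn (fun t _ => hf t) t₀ ⟨ht₀.1.le, ht₀.2.le⟩ hs hreg ε hε h₁ h₂
  have e₂ := hν.localization n Φ hΦ (segment f a b hab) hp hp H (fun t _ => hH t)
    hdiff.differentiableOn (fun t _ => hf t) t₀ ⟨ht₀.1.le, ht₀.2.le⟩ hs hreg ε hε h₁ h₂
  exact_mod_cast e₁.trans e₂.symm

omit hμ hν in
theorem det_real_smul_one (r : ℝ) (hr : r ≠ 0) :
    (r • (1 : Matrix (Fin n) (Fin n) ℂ)).det ≠ 0 := by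
  rw [Matrix.det_smul_of_tower, Matrix.det_one]
  exact smul_ne_zero (pow_ne_zero _ hr) one_ne_zero

/-- The path in a chart defined by a continuous family of Hermitian matrices. -/
def hermitianPath (hΦ : IsAdapted P₀ Φ) {X : Type*} [TopologicalSpace X]
    (H : X → Matrix (Fin n) (Fin n) ℂ)
    (hH : ∀ t, (H t).IsHermitian) (hc : Continuous H) : C(X, UManifold h) :=
  ⟨fun t => hermitianGraph hΦ ⟨H t, hH t⟩, (continuous_hermitianGraph hΦ).comp (hc.subtype_mk _)⟩

omit hμ hν in
theorem hermitianPath_space (hΦ : IsAdapted P₀ Φ) {X : Type*} [TopologicalSpace X]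
    {H : X → Matrix (Fin n) (Fin n) ℂ}
    (hH : ∀ t, (H t).IsHermitian) (hc : Continuous H) (t : X) :
    (hermitianPath hΦ H hH hc t).space = graphSpace Φ (H t) := rfl

omit hμ hν in
theorem hermitianPath_notMem (hΦ : IsAdapted P₀ Φ) {X : Type*} [TopologicalSpace X]
    {H : X → Matrix (Fin n) (Fin n) ℂ}
    {hH : ∀ t, (H t).IsHermitian} {hc : Continuous H} {t : X} (ht : (H t).det ≠ 0) :
    hermitianPath hΦ H hH hc t ∉ singularSet P₀ :=
  (hΦ.notMem_singularSet_iff_of_graphSpace (hermitianPath_space hΦ hH hc t)).2 ht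

theorem agreeOn_involutionPencil (hΦ : IsAdapted P₀ Φ) {σ : Matrix (Fin n) (Fin n) ℂ}
    (hσ : σ.IsHermitian) (hσσ : σ * σ = 1) (hne : σ ≠ 1) {k : ℝ} (hk : k ≠ 0) {a b t₀ : ℝ}
    (ht₀ : t₀ ∈ Set.Ioo a b) :
    AgreeOn μ ν (segment (hermitianPath hΦ (fun t => involutionPencil σ (k * (t - t₀)))
      (fun t => isHermitian_involutionPencil hσ _)
      ((continuous_involutionPencil σ).comp (by fun_prop))) a b (ht₀.1.trans ht₀.2)) := by
  refine agreeOn_of_localization hμ hν hΦ _ (fun t => isHermitian_involutionPencil hσ _) ?_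
    (fun t => rfl) ht₀ (fun t => ?_) (isRegularCrossing_involutionPencil hk t₀)
  · let _ : NormedAddCommGroup (Matrix (Fin n) (Fin n) ℂ) := Matrix.normedAddCommGroup
    let _ : NormedSpace ℝ (Matrix (Fin n) (Fin n) ℂ) := Matrix.normedSpace
    exact fun t => (hasDerivAt_involutionPencil σ k t₀ t).differentiableAt
  · rw [det_involutionPencil_eq_zero_iff hσσ hne, mul_eq_zero, sub_eq_zero]
    exact or_iff_right hk

omit hμ hν in
theorem neg_one_ne_one_matrix (hn : 0 < n) : (-1 : Matrix (Fin n) (Fin n) ℂ) ≠ 1 := by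
  intro h1
  have h2 := congrFun (congrFun h1 ⟨0, hn⟩) ⟨0, hn⟩
  simp at h2
  norm_num at h2

/-- The index of the constant path at the graph of the identity matrix is determined: it is the
difference of the indices of two paths with a single crossing. -/
theorem agreeOn_const_one (hΦ : IsAdapted P₀ Φ) (hn : 0 < n) {c d : ℝ} (hcd : c < d) :
    AgreeOn μ ν (segment (hermitianPath hΦ (fun _ => 1) (fun _ => Matrix.isHermitian_one)
      continuous_const) c d hcd) := by
  have hσ : (-1 : Matrix (Fin n) (Fin n) ℂ).IsHermitian := Matrix.isHermitian_one.neg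
  have hσσ : (-1 : Matrix (Fin n) (Fin n) ℂ) * -1 = 1 := by simp
  have hne := neg_one_ne_one_matrix hn
  have hpen : ∀ r : ℝ, involutionPencil (-1 : Matrix (Fin n) (Fin n) ℂ) r = r • 1 := by
    intro r
    unfold involutionPencil
    rw [smul_neg, ← sub_eq_add_neg, ← sub_smul]
    congr 1
    ring
  -- This is `(t - (c - 1)) • 1`, with its only crossing at `c - 1` and the value `1` at `c`.
  -- Localization applies on `[c - 2, c]` and on `[c - 2, d]`, and subtraction leaves `[c, d]`,
  -- where there is no crossing.
  let f := hermitianPath hΦ (fun t => involutionPencil (-1) (1 * (t - (c - 1))))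
      (fun t => isHermitian_involutionPencil hσ _)
      ((continuous_involutionPencil (-1)).comp (by fun_prop))
  have h₁ := agreeOn_involutionPencil hμ hν hΦ hσ hσσ hne one_ne_zero (a := c - 2) (b := c)
    (t₀ := c - 1) ⟨by linarith, by linarith⟩
  have h₂ := agreeOn_involutionPencil hμ hν hΦ hσ hσσ hne one_ne_zero (a := c - 2) (b := d)
    (t₀ := c - 1) ⟨by linarith, by linarith⟩
  have h₃ : AgreeOn μ ν (segment f c d hcd) := by
    refine agreeOn_right_of_catenation hμ hν (by linarith) hcd ?_ h₁ h₂
    apply hermitianPath_notMem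
    rw [Ne, det_involutionPencil_eq_zero_iff hσσ hne]
    linarith
  -- The scalar interpolates between `1` and `t - (c - 1)`. Both are at least `1` on `[c, d]`, so
  -- the ends stay invertible.
  let K : unitInterval × ℝ → Matrix (Fin n) (Fin n) ℂ := fun q =>
    ((1 - (q.1 : ℝ)) + q.1 * (q.2 - (c - 1))) • 1
  have hK : ∀ q, (K q).IsHermitian := fun q => Matrix.isHermitian_one.smul (IsSelfAdjoint.all _)
  have hKc : Continuous K := by fun_prop
  refine agreeOn_of_homotopy hμ hν hcd (hermitianPath hΦ K hK hKc)
    (ContinuousMap.continuous _) (fun t _ => ?_) (fun t _ => ?_) (fun s => ?_) (fun s => ?_) h₃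
  · apply UManifold.ext
    rw [hermitianPath_space, hermitianPath_space]
    simp [K]
  · apply UManifold.ext
    rw [hermitianPath_space, hermitianPath_space, hpen]
    simp [K]
  · apply hermitianPath_notMem
    apply det_real_smul_one
    simp
  · apply hermitianPath_notMem
    apply det_real_smul_one
    have := s.2.1
    have h5 : (1 - (s : ℝ)) + s * (d - (c - 1)) = 1 + s * (d - c) := by ring
    simp only [h5]
    nlinarith [mul_nonneg this (sub_pos.2 hcd).le]

/-- The index of a path between an involution and the identity matrix is determined. -/
theorem agreeOn_involutionPencil' (hΦ : IsAdapted P₀ Φ) (hn : 0 < n)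
    {σ : Matrix (Fin n) (Fin n) ℂ}
    (hσ : σ.IsHermitian) (hσσ : σ * σ = 1) {k : ℝ} (hk : k ≠ 0) {a b t₀ : ℝ}
    (ht₀ : t₀ ∈ Set.Ioo a b) :
    AgreeOn μ ν (segment (hermitianPath hΦ (fun t => involutionPencil σ (k * (t - t₀)))
      (fun t => isHermitian_involutionPencil hσ _)
      ((continuous_involutionPencil σ).comp (by fun_prop))) a b (ht₀.1.trans ht₀.2)) := by
  -- For `σ = 1` the pencil is constant and has no crossing, so localization says nothing about it.
  by_cases hne : σ = 1
  · subst hne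
    have h1 := agreeOn_const_one hμ hν hΦ hn (ht₀.1.trans ht₀.2)
    rwa [← segment_congr (g := hermitianPath hΦ (fun _ => 1) (fun _ => Matrix.isHermitian_one)
      continuous_const) (ht₀.1.trans ht₀.2)] at h1
    intro t _
    apply UManifold.ext
    rw [hermitianPath_space, hermitianPath_space, involutionPencil_one_left]
  · exact agreeOn_involutionPencil hμ hν hΦ hσ hσσ hne hk ht₀

/-- The index of an admissible path inside one chart is determined. -/
theorem agreeOn_of_mem_chart (hΦ : IsAdapted P₀ Φ) (hn : 0 < n) {f : C(ℝ, UManifold h)}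
    {c d : ℝ} (hcd : c < d) (hf : ∀ t ∈ Set.Icc c d, f t ∈ chart h Φ) :
    AgreeOn μ ν (segment f c d hcd) := by
  intro hadm
  obtain ⟨hfc, hfd⟩ := (segment_mem_admissible hcd).1 hadm
  revert hadm
  change AgreeOn μ ν (segment f c d hcd)
  have hmc := Set.left_mem_Icc.2 hcd.le
  have hmd := Set.right_mem_Icc.2 hcd.le
  -- Clamping to `[c, d]` makes the matrix path continuous and Hermitian on the whole line.
  let pr : ℝ → ℝ := fun t => Set.projIcc c d hcd.le t
  have hpr : ∀ t, pr t ∈ Set.Icc c d := fun t => (Set.projIcc c d hcd.le t).2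
  have hprc : Continuous pr := continuous_subtype_val.comp continuous_projIcc
  have hpre : ∀ t ∈ Set.Icc c d, pr t = t := fun t ht => by
    simp only [pr]; rw [Set.projIcc_of_mem _ ht]
  let K : ℝ → Matrix (Fin n) (Fin n) ℂ := fun t => slope Φ (f (pr t))
  have hK : ∀ t, (K t).IsHermitian := fun t => hΦ.isHermitian_slope (hf _ (hpr t))
  have hKc : Continuous K := (continuousOn_slope Φ).comp_continuous
    (f.continuous.comp hprc) fun t => hf _ (hpr t)
  have hfK : ∀ t ∈ Set.Icc c d, (f t).space = graphSpace Φ (K t) := fun t ht => by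
    simp only [K]; rw [hpre t ht]; exact graphSpace_slope (hf t ht)
  have hdc : (K c).det ≠ 0 := (hΦ.notMem_singularSet_iff_of_graphSpace (hfK c hmc)).1 hfc
  have hdd : (K d).det ≠ 0 := (hΦ.notMem_singularSet_iff_of_graphSpace (hfK d hmd)).1 hfd
  obtain ⟨σ, hσ, hσσ, hσs⟩ := exists_involution_segment (hK c) hdc
  obtain ⟨τ, hτ, hττ, hτs⟩ := exists_involution_segment (hK d) hdd
  let m := (c + d) / 2
  have hcm : c < m := by simp only [m]; linarith
  have hmd' : m < d := by simp only [m]; linarith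
  -- With crossings `t₁`, `t₂` at the quarter points and slopes `k`, `-k`, the pencil parameter runs
  -- from `-1` to `1` on `[c, m]` and back to `-1` on `[m, d]`.
  let k := 4 / (d - c)
  have hk : k ≠ 0 := div_ne_zero (by norm_num) (sub_pos.2 hcd).ne'
  let t₁ := (3 * c + d) / 4
  let t₂ := (c + 3 * d) / 4
  have ht₁ : t₁ ∈ Set.Ioo c m := by constructor <;> simp only [t₁, m] <;> linarith
  have ht₂ : t₂ ∈ Set.Ioo m d := by constructor <;> simp only [t₂, m] <;> linarith
  have hdc0 : d - c ≠ 0 := (sub_pos.2 hcd).ne'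
  have hk₁ : k * (c - t₁) = -1 := by simp only [k, t₁]; field_simp; ring
  have hk₂ : k * (m - t₁) = 1 := by simp only [k, t₁, m]; field_simp; ring
  have hk₃ : -k * (m - t₂) = 1 := by simp only [k, t₂, m]; field_simp; ring
  have hk₄ : -k * (d - t₂) = -1 := by simp only [k, t₂]; field_simp; ring
  -- The model path goes from `σ` to `1` to `τ`. It can be cut at `m`, where it is the identity
  -- matrix.
  let R : ℝ → Matrix (Fin n) (Fin n) ℂ := fun t =>
    if t ≤ m then involutionPencil σ (k * (t - t₁)) else involutionPencil τ (-k * (t - t₂))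
  have hR : ∀ t, (R t).IsHermitian := fun t => by
    simp only [R]
    split_ifs
    · exact isHermitian_involutionPencil hσ _
    · exact isHermitian_involutionPencil hτ _
  have hRc : Continuous R := by
    refine Continuous.if_le ((continuous_involutionPencil σ).comp (by fun_prop))
      ((continuous_involutionPencil τ).comp (by fun_prop)) continuous_id continuous_const ?_
    rintro t rfl
    rw [hk₂, hk₃, involutionPencil_one_right, involutionPencil_one_right]
  have hRleft : ∀ t ≤ m, R t = involutionPencil σ (k * (t - t₁)) := fun t ht => if_pos ht
  have hRright : ∀ t, m ≤ t → R t = involutionPencil τ (-k * (t - t₂)) := by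
    intro t ht
    rcases eq_or_lt_of_le ht with rfl | ht
    · rw [hRleft _ le_rfl, hk₂, hk₃, involutionPencil_one_right, involutionPencil_one_right]
    · exact if_neg ht.not_ge
  have hRagree : AgreeOn μ ν (segment (hermitianPath hΦ R hR hRc) c d hcd) := by
    refine agreeOn_catenation hμ hν hcm hmd' ?_ ?_ ?_
    · apply hermitianPath_notMem
      rw [hRleft _ le_rfl, hk₂, involutionPencil_one_right, Matrix.det_one]
      exact one_ne_zero
    · rw [segment_congr hcm fun t ht => UManifold.ext ?_]
      · exact agreeOn_involutionPencil' hμ hν hΦ hn hσ hσσ hk ht₁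
      · rw [hermitianPath_space, hermitianPath_space, hRleft t ht.2]
    · rw [segment_congr hmd' fun t ht => UManifold.ext ?_]
      · exact agreeOn_involutionPencil' hμ hν hΦ hn hτ hττ (neg_ne_zero.2 hk) ht₂
      · rw [hermitianPath_space, hermitianPath_space, hRright t ht.1]
  -- The straight homotopy stays Hermitian by convexity, and its ends run along the invertible
  -- segments from `K c` to `σ` and from `K d` to `τ`.
  let Q : unitInterval × ℝ → Matrix (Fin n) (Fin n) ℂ := fun q =>
    (1 - (q.1 : ℝ)) • K q.2 + (q.1 : ℝ) • R q.2
  have hQ : ∀ q, (Q q).IsHermitian := fun q =>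
    ((hK _).smul (IsSelfAdjoint.all _)).add ((hR _).smul (IsSelfAdjoint.all _))
  have hQc : Continuous Q := by fun_prop
  refine agreeOn_of_homotopy hμ hν hcd (hermitianPath hΦ Q hQ hQc)
    (ContinuousMap.continuous _) (fun t ht => ?_) (fun t _ => ?_) (fun s => ?_) (fun s => ?_)
    hRagree
  · apply UManifold.ext
    rw [hermitianPath_space, hfK t ht]
    simp [Q]
  · apply UManifold.ext
    rw [hermitianPath_space, hermitianPath_space]
    simp [Q]
  · apply hermitianPath_notMem
    simp only [Q]
    rw [hRleft c hcm.le, hk₁, involutionPencil_neg_one]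
    exact hσs s s.2
  · apply hermitianPath_notMem
    simp only [Q]
    rw [hRright d hmd'.le, hk₄, involutionPencil_neg_one]
    exact hτs s s.2

omit hμ hν in
-- Only `z = 1` needs the restriction to positive angles: the next angle after `0` that gives `1` is
-- `2π`.
theorem eventually_exp_ne (z : Circle) : ∀ᶠ θ : ℝ in nhdsWithin 0 (Set.Ioi 0), Circle.exp θ ≠ z := by
  by_cases hz : z = 1
  · subst hz
    have h1 : Set.Ioo (0 : ℝ) (2 * Real.pi) ∈ nhdsWithin (0 : ℝ) (Set.Ioi 0) :=
      Ioo_mem_nhdsGT (by positivity)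
    filter_upwards [h1] with θ hθ h2
    rw [← Circle.exp_zero, Circle.exp_eq_exp] at h2
    obtain ⟨m, hm⟩ := h2
    rw [zero_add] at hm
    have h3 : (0 : ℝ) < m := by
      by_contra h4
      nlinarith [hθ.1, Real.pi_pos]
    have h5 : (m : ℝ) < 1 := by
      by_contra h4
      nlinarith [hθ.2, Real.pi_pos]
    have h6 : 0 < m := by exact_mod_cast h3
    have h7 : m < 1 := by exact_mod_cast h5
    omega
  · have h1 : ContinuousAt (fun θ : ℝ => Circle.exp θ) 0 := Circle.exp.continuous.continuousAt
    refine (h1.eventually_ne ?_).filter_mono nhdsWithin_le_nhds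
    rw [Circle.exp_zero]
    exact Ne.symm hz

omit hμ hν in
theorem eventually_rotate_notMem (hΦ : IsAdapted P₀ Φ) (P : UManifold h) :
    ∀ᶠ θ : ℝ in nhdsWithin 0 (Set.Ioi 0), rotate hΦ (Circle.exp θ) P ∉ singularSet P₀ := by
  have hfin := finite_rotate_mem_singularSet hΦ P
  have h1 := (Filter.eventually_all_finite hfin).2 fun z _ => eventually_exp_ne z
  filter_upwards [h1] with θ hθ hmem
  exact hθ _ hmem rfl

omit hμ hν in
theorem eventually_forall_rotate_notMem (hΦ : IsAdapted P₀ Φ) {P : UManifold h}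
    (hP : P ∉ singularSet P₀) :
    ∀ᶠ θ : ℝ in nhdsWithin 0 (Set.Ioi 0), ∀ s : unitInterval,
      rotate hΦ (Circle.exp (s * θ)) P ∉ singularSet P₀ := by
  have hc : Continuous fun θ : ℝ => rotate hΦ (Circle.exp θ) P :=
    continuous_rotate_exp hΦ continuous_id continuous_const
  have h1 : ∀ᶠ θ : ℝ in nhds 0, rotate hΦ (Circle.exp θ) P ∉ singularSet P₀ := by
    have h0 : rotate hΦ (Circle.exp 0) P ∈ {P : UManifold h | P ∉ singularSet P₀} := by
      rw [Circle.exp_zero, rotate_one]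
      exact hP
    exact hc.continuousAt (hΦ.isOpen_compl_singularSet.mem_nhds h0)
  obtain ⟨ε, hε, hball⟩ := Metric.eventually_nhds_iff.1 h1
  filter_upwards [Ioo_mem_nhdsGT hε] with θ hθ s
  apply hball
  rw [Real.dist_0_eq_abs, abs_of_nonneg (mul_nonneg s.2.1 hθ.1.le)]
  exact (mul_le_of_le_one_left hθ.1.le s.2.2).trans_lt hθ.2

/-- Two maps that satisfy the axioms agree on all admissible paths. -/
theorem agreeOn_segment (hΦ : IsAdapted P₀ Φ) (hn : 0 < n) (f : C(ℝ, UManifold h)) {a b : ℝ}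
    (hab : a < b) : AgreeOn μ ν (segment f a b hab) := by
  intro hadm
  obtain ⟨hfa, hfb⟩ := (segment_mem_admissible hab).1 hadm
  revert hadm
  change AgreeOn μ ν (segment f a b hab)
  let W : ℝ × ℝ → UManifold h := fun q => rotate hΦ (Circle.exp q.1) (f q.2)
  have hW : Continuous W := continuous_rotate_exp hΦ continuous_fst (f.continuous.comp continuous_snd)
  have hW0 : ∀ t, W (0, t) = f t := fun t => by
    simp only [W]
    rw [Circle.exp_zero, rotate_one]
  -- The index `(c, ε)` stands for the times near which every rotation by an angle below `ε` stays
  -- in the chart of the shear by `c`. The margin `ε` allows the partition to be chosen before the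
  -- angle.
  let V : ℝ × ℝ → Set (Set.Icc a b) := fun i => interior
    {t | ∀ θ : ℝ, |θ| < i.2 → W (θ, t) ∈ chart h ((shear n i.1).trans Φ)}
  obtain ⟨τ, hτ0, hτm, ⟨m, hτb⟩, hτV⟩ := exists_monotone_Icc_subset_open_cover_Icc hab.le
    (c := fun i : {i : ℝ × ℝ // 0 < i.2} => V i.1) (fun _ => isOpen_interior) (by
      intro t _
      obtain ⟨c, hc⟩ := exists_mem_chart_shear hΦ (f t)
      have h1 : ∀ᶠ q in nhds ((0 : ℝ), (t : ℝ)), W q ∈ chart h ((shear n c).trans Φ) := by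
        refine hW.continuousAt.eventually_mem ((isOpen_chart _).mem_nhds ?_)
        rw [hW0]
        exact hc
      obtain ⟨ε, hε, hball⟩ := Metric.eventually_nhds_iff.1 h1
      refine Set.mem_iUnion.2 ⟨⟨(c, ε), hε⟩, ?_⟩
      rw [mem_interior_iff_mem_nhds, Metric.mem_nhds_iff]
      refine ⟨ε, hε, fun t' ht' θ hθ => hball ?_⟩
      rw [Prod.dist_eq, max_lt_iff]
      exact ⟨by rwa [Real.dist_0_eq_abs], ht'⟩)
  choose i hi using hτV
  -- A small positive angle keeps each piece in its chart, makes all partition points nonsingular,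
  -- and leaves both ends nonsingular during the whole rotation.
  have hev : ∀ᶠ θ : ℝ in nhdsWithin 0 (Set.Ioi 0),
      (∀ k ∈ Finset.range m, |θ| < (i k).1.2) ∧
      (∀ k ∈ Finset.range (m + 1), rotate hΦ (Circle.exp θ) (f (τ k)) ∉ singularSet P₀) ∧
      (∀ s : unitInterval, rotate hΦ (Circle.exp (s * θ)) (f a) ∉ singularSet P₀) ∧
      (∀ s : unitInterval, rotate hΦ (Circle.exp (s * θ)) (f b) ∉ singularSet P₀) := by
    refine Filter.Eventually.and ?_ (Filter.Eventually.and ?_ (Filter.Eventually.and ?_ ?_))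
    · rw [Filter.eventually_all_finset]
      intro k _
      filter_upwards [Ioo_mem_nhdsGT (i k).2] with θ hθ
      rw [abs_of_pos hθ.1]
      exact hθ.2
    · rw [Filter.eventually_all_finset]
      exact fun k _ => eventually_rotate_notMem hΦ _
    · exact eventually_forall_rotate_notMem hΦ hfa
    · exact eventually_forall_rotate_notMem hΦ hfb
  obtain ⟨θ, hθ₁, hθ₂, hθa, hθb⟩ := hev.exists
  let g : C(ℝ, UManifold h) := ⟨fun t => W (θ, t), hW.comp (continuous_const.prodMk continuous_id)⟩
  have hind : ∀ k ≤ m, ∀ hk : a < τ k, AgreeOn μ ν (segment g a (τ k) hk) := by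
    intro k
    induction k with
    | zero =>
      intro _ hk
      rw [hτ0] at hk
      exact absurd hk (lt_irrefl a)
    | succ k ih =>
      intro hkm hk
      have hle : (τ k : ℝ) ≤ τ (k + 1) := hτm k.le_succ
      -- The partition is only weakly monotone, so consecutive points may coincide.
      rcases eq_or_lt_of_le hle with heq | hlt
      · have h1 := ih (by omega) (by rwa [heq])
        convert h1 using 2
        exact heq.symm
      · have h1 : AgreeOn μ ν (segment g (τ k) (τ (k + 1)) hlt) := by
          refine agreeOn_of_mem_chart hμ hν (hΦ.shear (i k).1.1) hn hlt fun t ht => ?_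
          have hmem : t ∈ Set.Icc a b :=
            ⟨(τ k).2.1.trans ht.1, ht.2.trans (τ (k + 1)).2.2⟩
          exact interior_subset (hi k (show (⟨t, hmem⟩ : Set.Icc a b) ∈ _ from ht)) θ
            (hθ₁ k (Finset.mem_range.2 (by omega)))
        rcases eq_or_lt_of_le (τ k).2.1 with heq | hlt'
        · convert h1 using 2
        · exact agreeOn_catenation hμ hν hlt' hlt (hθ₂ k (Finset.mem_range.2 (by omega)))
            (ih (by omega) hlt') h1
  have hb : (τ m : ℝ) = b := by rw [hτb m le_rfl]
  have hgab : AgreeOn μ ν (segment g a b hab) := by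
    have h1 := hind m le_rfl (by rwa [hb])
    convert h1 using 2
    exact hb.symm
  -- Undoing the rotation is a homotopy through paths with nonsingular ends.
  refine agreeOn_of_homotopy hμ hν hab (fun q => W (q.1 * θ, q.2)) (hW.comp (by fun_prop))
    (fun t _ => ?_) (fun t _ => ?_) hθa hθb hgab
  · simp only [Set.Icc.coe_zero, zero_mul, hW0]
  · simp only [Set.Icc.coe_one, one_mul]
    rfl

theorem isEMIndex_unique (hΦ : IsAdapted P₀ Φ) (hn : 0 < n) : μ = ν := by
  funext ⟨p, hp⟩
  have h1 := agreeOn_segment hμ hν hΦ hn ⟨p.extend, p.continuous_extend⟩ p.lt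
  rw [segment_extend] at h1
  exact h1 hp

end Uniqueness

end EdwardsMaslov

end

theorem mainTheorem2 {S : Type*} [NormedAddCommGroup S] [InnerProductSpace ℂ S]
    [FiniteDimensional ℂ S] [Nontrivial S]
    (h : S →ₗ⋆[ℂ] S →ₗ[ℂ] ℂ) (hh : EdwardsMaslov.IsSuperhermitian h)
    (P₀ : EdwardsMaslov.UManifold h) :
    (∃! μ : EdwardsMaslov.UPath.admissible P₀ → ℤ,
      EdwardsMaslov.IsEMIndex P₀ (EdwardsMaslov.UPath.admissible P₀) μ) ∧
    (∃ μ : ↥(Set.univ : Set (EdwardsMaslov.UPath h)) → ℤ,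
      EdwardsMaslov.IsEMIndex P₀ Set.univ μ) := by
  obtain ⟨n, Φ, hΦ⟩ := EdwardsMaslov.exists_isAdapted hh P₀
  -- Positivity of `n` gives `-1 ≠ 1` for matrices, hence a crossing path from which the index of
  -- the constant path is computed.
  have hn : 0 < n := by
    have h1 := EdwardsMaslov.finrank_of_coordinates Φ
    have h2 : 0 < Module.finrank ℂ S := Module.finrank_pos
    omega
  exact ⟨⟨_, EdwardsMaslov.isEMIndex_emIndex hΦ _, fun ν hν =>
    EdwardsMaslov.isEMIndex_unique hν (EdwardsMaslov.isEMIndex_emIndex hΦ _) hΦ hn⟩,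
    ⟨_, EdwardsMaslov.isEMIndex_emIndex hΦ _⟩⟩
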